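/- Let $\mathbb H$ be the upper half-plane and let $\Gamma_{1,2}\subset SL_2(\mathbb Z)$ be the subgroup of matrices $\gamma=\begin{pmatrix}a&b\\c&d\end{pmatrix}$ with $ac\equiv bd\equiv 0 \pmod 2$, acting on $\mathbb H$ by $\gamma\tau=\frac{a\tau+b}{c\tau+d}$. For $x\in\mathbb C$, $\tau\in\mathbb H$ put $$\theta(x,\tau)=\sum_{n\in\mathbb Z}e^{\pi i n^2\tau+2\pi i n x},\qquad \kappa(y,x,\tau)=\sum_{n\in\mathbb Z}\frac{e^{\pi i\tau n^2+2\pi i n x}}{e^{2\pi i n\tau}-e^{2\pi i y}}\quad (y\notin\mathbb Z+\mathbb Z\tau),$$ $$\kappa_0(x,\tau)=e^{3\pi i\tau/4}\,\kappa\!\left(\tfrac{\tau+1}{2},x,\tau\right),$$ and for $\gamma\in\Gamma_{1,2}$ put $$\chi(\gamma)=\begin{cases}(-1)^{a/2}e^{\frac{\pi i}{4}(ab+cd)},& a\text{ even},\\(-1)^{c/2}e^{\frac{\pi i}{4}(ab+cd)},& c\text{ even}.\end{cases}$$ (1) For every $\gamma\in\Gamma_{1,2}$ there is exactly one number $\zeta(\gamma)\in\mathbb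 C$ such that, with the principal branch of the square root, $$\theta\!\left(\tfrac{x}{c\tau+d},\gamma\tau\right)=\zeta(\gamma)(c\tau+d)^{1/2}e^{\pi i\frac{cx^2}{c\tau+d}}\,\theta(x,\tau)\qquad(x\in\mathbb C,\ \tau\in\mathbb H).$$ It satisfies $\zeta(\gamma)^8=1$, and $\zeta(\gamma)^2=(-1)^{(d-1)/2}$ if $d$ is odd, $\zeta(\gamma)^2=e^{-\pi i c/2}$ if $c$ is odd (equivalently, $d$ is even). Moreover $\chi$ is a character of $\Gamma_{1,2}$ with values in the fourth roots of unity. (2) For every $\gamma\in\Gamma_{1,2}$ the function $$\kappa_0\!\left(\tfrac{x}{c\tau+d},\gamma\tau\right)-\zeta(\gamma)^{-2}\chi(\gamma)^{-1}(c\tau+d)\,e^{\pi i\left(\frac1{c\tau+d}-1\right)x}\,\kappa_0(x,\tau)$$ of $(x,\tau)$ is holomorphic on $\mathbb C\times\mathbb H$ and is divisible by $\theta(x,\tau)$ in the ring of holomorphic functions on $\mathbb C\times\mathbb H$. (3) Let $G=\mathbb Z^2\rtimes\Gamma_{1,2}$ act on $\mathbb C\times\mathbb H$, where $(m,n)\in\mathbb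 Z^2$ acts by $(x,\tau)\mapsto(x+m+n\tau,\tau)$ and $\gamma$ by $(x,\tau)\mapsto(\frac{x}{c\tau+d},\gamma\tau)$; the quotient is the universal elliptic curve over the stack of elliptic curves with a non-trivial point of order $2$. The pair $(\kappa(\frac{\tau+1}2,x,\tau),\theta(x,\tau))$ is a global section of a rank-$2$ extension bundle on this quotient. Precisely, there is a 1-cocycle $C$ of $G$ with values in the holomorphic maps $\mathbb C\times\mathbb H\to GL_2(\mathbb C)$, that is, $C(gh)(p)=C(g)(hp)\,C(h)(p)$, of the form $$C(m,n)=\begin{pmatrix}e^{\pi i n(\tau+1)}&*\\0&e^{-\pi i n^2\tau-2\pi i n x}\end{pmatrix},\qquad C(\gamma)=\begin{pmatrix}k_\gamma(\tau)\,e^{\pi i\left(\frac1{c\tau+d}-1\right)x}&*\\0&\zeta(\gamma)(c\tau+d)^{1/2}e^{\pi i\frac{cx^2}{c\tau+d}}\end{pmatrix},$$ where $k_\gamma(\tau)=e^{\frac{3\pi i}4(\tau-\gamma\tau)}\zeta(\gamma)^{-2}\chi(\gamma)^{-1}(c\tau+d)$, where $C(1,0)$ is the identity matrix and the upper right entry of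 $C(0,1)$ is $1$, such that the holomorphic column vector $s(x,\tau)=\left(\kappa(\frac{\tau+1}2,x,\tau),\theta(x,\tau)\right)^{T}$ satisfies $s(gp)=C(g)(p)\,s(p)$ for all $g\in G$, $p\in\mathbb C\times\mathbb H$. -/

import Mathlib

open Complex
open UpperHalfPlane hiding I
open scoped Real MatrixGroups Matrix

noncomputable section

namespace AppellKappa

/-- The theta group `Γ_{1,2}`: matrices `(a b; c d)` in `SL₂(ℤ)` with `ac ≡ bd ≡ 0 mod 2`. -/
def Gamma12 : Subgroup SL(2, ℤ) where
  carrier := {γ | 2 ∣ γ 0 0 * γ 1 0 ∧ 2 ∣ γ 0 1 * γ 1 1}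
  one_mem' := by simp
  mul_mem' := by
    rintro γ δ ⟨⟨u, hu⟩, ⟨v, hv⟩⟩ ⟨⟨s, hs⟩, ⟨t, ht⟩⟩
    simp only [Set.mem_ofPred_eq, Matrix.SpecialLinearGroup.coe_mul, Matrix.mul_apply,
      Fin.sum_univ_two]
    constructor
    · exact ⟨u * (δ 0 0) ^ 2 + (γ 0 0 * γ 1 1 + γ 0 1 * γ 1 0) * s + v * (δ 1 0) ^ 2, by
        linear_combination (δ 0 0) ^ 2 * hu + (γ 0 0 * γ 1 1 + γ 0 1 * γ 1 0) * hs
          + (δ 1 0) ^ 2 * hv⟩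
    · exact ⟨u * (δ 0 1) ^ 2 + (γ 0 0 * γ 1 1 + γ 0 1 * γ 1 0) * t + v * (δ 1 1) ^ 2, by
        linear_combination (δ 0 1) ^ 2 * hu + (γ 0 0 * γ 1 1 + γ 0 1 * γ 1 0) * ht
          + (δ 1 1) ^ 2 * hv⟩
  inv_mem' := by
    rintro γ ⟨⟨u, hu⟩, ⟨v, hv⟩⟩
    have hdet : γ 0 0 * γ 1 1 - γ 0 1 * γ 1 0 = 1 := by
      have := γ.det_coe
      rwa [Matrix.det_fin_two] at this
    change 2 ∣ (γ⁻¹ : SL(2, ℤ)) 0 0 * (γ⁻¹ : SL(2, ℤ)) 1 0 ∧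
      2 ∣ (γ⁻¹ : SL(2, ℤ)) 0 1 * (γ⁻¹ : SL(2, ℤ)) 1 1
    rw [Matrix.SpecialLinearGroup.SL2_inv_expl]
    change 2 ∣ γ 1 1 * -γ 1 0 ∧ 2 ∣ -γ 0 1 * γ 0 0
    constructor
    · exact ⟨-((γ 1 1) ^ 2 * u - (γ 1 0) ^ 2 * v), by
        linear_combination (-(γ 1 1) ^ 2) * hu + (γ 1 0) ^ 2 * hv
          + (γ 1 0 * γ 1 1) * hdet⟩
    · exact ⟨-((γ 0 0) ^ 2 * v - (γ 0 1) ^ 2 * u), by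
        linear_combination (-(γ 0 0) ^ 2) * hv + (γ 0 1) ^ 2 * hu
          + (γ 0 0 * γ 0 1) * hdet⟩

/-- The entry `a` of `γ = (a b; c d)`. -/
def ea (γ : Gamma12) : ℤ := (γ : SL(2, ℤ)) 0 0
/-- The entry `b` of `γ = (a b; c d)`. -/
def eb (γ : Gamma12) : ℤ := (γ : SL(2, ℤ)) 0 1
/-- The entry `c` of `γ = (a b; c d)`. -/
def ec (γ : Gamma12) : ℤ := (γ : SL(2, ℤ)) 1 0
/-- The entry `d` of `γ = (a b; c d)`. -/
def ed (γ : Gamma12) : ℤ := (γ : SL(2, ℤ)) 1 1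

/-- The automorphy factor `cτ + d`. -/
def autFactor (γ : Gamma12) (τ : ℍ) : ℂ := (ec γ : ℂ) * (τ : ℂ) + (ed γ : ℂ)

theorem det_eq (γ : Gamma12) : ea γ * ed γ - eb γ * ec γ = 1 := by
  have := (γ : SL(2, ℤ)).det_coe
  rwa [Matrix.det_fin_two] at this

theorem autFactor_ne_zero (γ : Gamma12) (τ : ℍ) : autFactor γ τ ≠ 0 := by
  intro h
  have him := congrArg Complex.im h
  have hre := congrArg Complex.re h
  simp [autFactor, τ.im_ne_zero] at him hre
  have hdet := det_eq γ
  simp [him] at hre hdet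
  simp [hre] at hdet

theorem coe_smul_eq (γ : Gamma12) (τ : ℍ) :
    (((γ : SL(2, ℤ)) • τ : ℍ) : ℂ) = ((ea γ : ℂ) * τ + eb γ) / autFactor γ τ := by
  rw [UpperHalfPlane.coe_specialLinearGroup_apply]
  simp [ea, eb, ec, ed, autFactor]

/-- The action of `Γ_{1,2}` on the lattice `ℤ²` by which conjugation by `γ` moves the translation
`x ↦ x + m + nτ`: `(m, n) ↦ (am - bn, -cm + dn)`. -/
def latticeEquiv (γ : Gamma12) : Multiplicative (ℤ × ℤ) ≃* Multiplicative (ℤ × ℤ) where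
  toFun v := Multiplicative.ofAdd
    (ea γ * v.toAdd.1 - eb γ * v.toAdd.2, -ec γ * v.toAdd.1 + ed γ * v.toAdd.2)
  invFun v := Multiplicative.ofAdd
    (ed γ * v.toAdd.1 + eb γ * v.toAdd.2, ec γ * v.toAdd.1 + ea γ * v.toAdd.2)
  left_inv v := by
    apply Multiplicative.toAdd.injective
    ext
    · simp only [toAdd_ofAdd]; linear_combination v.toAdd.1 * det_eq γ
    · simp only [toAdd_ofAdd]; linear_combination v.toAdd.2 * det_eq γ
  right_inv v := by
    apply Multiplicative.toAdd.injective
    ext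
    · simp only [toAdd_ofAdd]; linear_combination v.toAdd.1 * det_eq γ
    · simp only [toAdd_ofAdd]; linear_combination v.toAdd.2 * det_eq γ
  map_mul' v w := by
    apply Multiplicative.toAdd.injective
    ext
    · simp only [toAdd_ofAdd, toAdd_mul, Prod.fst_add, Prod.snd_add]; ring
    · simp only [toAdd_ofAdd, toAdd_mul, Prod.fst_add, Prod.snd_add]; ring

theorem entries_mul (γ δ : Gamma12) :
    ea (γ * δ) = ea γ * ea δ + eb γ * ec δ ∧ eb (γ * δ) = ea γ * eb δ + eb γ * ed δ ∧
    ec (γ * δ) = ec γ * ea δ + ed γ * ec δ ∧ ed (γ * δ) = ec γ * eb δ + ed γ * ed δ := by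
  simp [ea, eb, ec, ed, Matrix.mul_apply, Fin.sum_univ_two]

/-- `latticeEquiv` as a homomorphism from `Γ_{1,2}`. -/
def latticeHom : Gamma12 →* MulAut (Multiplicative (ℤ × ℤ)) where
  toFun := latticeEquiv
  map_one' := by
    ext v <;> simp [latticeEquiv, ea, eb, ec, ed]
  map_mul' γ δ := by
    obtain ⟨h1, h2, h3, h4⟩ := entries_mul γ δ
    ext v
    · simp only [latticeEquiv, MulAut.mul_apply, MulEquiv.coe_mk, Equiv.coe_fn_mk, toAdd_ofAdd,
        h1, h2]
      ring
    · simp only [latticeEquiv, MulAut.mul_apply, MulEquiv.coe_mk, Equiv.coe_fn_mk, toAdd_ofAdd,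
        h3, h4]
      ring

/-- The group `G = ℤ² ⋊ Γ_{1,2}`. -/
abbrev UnivGroup : Type := Multiplicative (ℤ × ℤ) ⋊[latticeHom] Gamma12

/-- The translation `(m, n)` as an element of `G`. -/
def transl (m n : ℤ) : UnivGroup := SemidirectProduct.inl (Multiplicative.ofAdd (m, n))

/-- The matrix `γ` as an element of `G`. -/
def modular (γ : Gamma12) : UnivGroup := SemidirectProduct.inr γ

theorem autFactor_mul (γ δ : Gamma12) (τ : ℍ) :
    autFactor (γ * δ) τ = autFactor γ ((δ : SL(2, ℤ)) • τ) * autFactor δ τ := by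
  obtain ⟨-, -, h3, h4⟩ := entries_mul γ δ
  have h0 := autFactor_ne_zero δ τ
  rw [autFactor, autFactor, coe_smul_eq, h3, h4]
  field_simp
  simp only [autFactor]
  push_cast
  ring

/-- The action of `G` on `ℂ × ℍ`: `(m, n)` acts by `(x, τ) ↦ (x + m + nτ, τ)` and `γ` acts by
`(x, τ) ↦ (x / (cτ + d), γτ)`.  The quotient is the universal elliptic curve over the stack of
elliptic curves with a non-trivial point of order two. -/
def act (g : UnivGroup) (p : ℂ × ℍ) : ℂ × ℍ :=
  (p.1 / autFactor g.right p.2 + (g.left.toAdd.1 : ℂ)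
      + (g.left.toAdd.2 : ℂ) * (((g.right : SL(2, ℤ)) • p.2 : ℍ) : ℂ),
    (g.right : SL(2, ℤ)) • p.2)

theorem act_mul (g h : UnivGroup) (p : ℂ × ℍ) : act (g * h) p = act g (act h p) := by
  have e1 := autFactor_ne_zero g.right ((h.right : SL(2, ℤ)) • p.2)
  have e2 := autFactor_ne_zero h.right p.2
  have hdet : (ea g.right : ℂ) * ed g.right - eb g.right * ec g.right = 1 := by
    exact_mod_cast det_eq g.right
  refine Prod.ext ?_ ?_
  · simp only [act, SemidirectProduct.mul_right, SemidirectProduct.mul_left, autFactor_mul,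
      Subgroup.coe_mul, mul_smul, toAdd_mul, Prod.fst_add, Prod.snd_add]
    change _ / _ + ((_ + (ea g.right * h.left.toAdd.1 - eb g.right * h.left.toAdd.2) : ℤ) : ℂ)
      + ((_ + (-ec g.right * h.left.toAdd.1 + ed g.right * h.left.toAdd.2) : ℤ) : ℂ) * _ = _
    rw [coe_smul_eq g.right]
    generalize ((h.right : SL(2, ℤ)) • p.2 : ℍ) = σ at *
    push_cast
    field_simp
    simp only [autFactor]
    linear_combination ((ec h.right : ℂ) * p.2 + ed h.right) *
      ((h.left.toAdd.1 : ℂ) + h.left.toAdd.2 * (σ : ℂ)) * hdet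
  · simp only [act, SemidirectProduct.mul_right, Subgroup.coe_mul, mul_smul]

instance univAction : MulAction UnivGroup (ℂ × ℍ) where
  smul := act
  one_smul p := by
    change act 1 p = p
    ext <;> simp [act, autFactor, ec, ed]
  mul_smul := act_mul

/-- Holomorphic functions on `ℂ × ℍ`. -/
def IsHolo (f : ℂ × ℍ → ℂ) : Prop :=
  DifferentiableOn ℂ (fun w : ℂ × ℂ => f (w.1, ofComplex w.2)) {w | 0 < w.2.im}

/-- The ring of holomorphic functions on `ℂ × ℍ`. -/
def holoRing : Subring (ℂ × ℍ → ℂ) where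
  carrier := {f | IsHolo f}
  mul_mem' hf hg := DifferentiableOn.mul hf hg
  one_mem' := differentiableOn_const 1
  add_mem' hf hg := DifferentiableOn.add hf hg
  zero_mem' := differentiableOn_const 0
  neg_mem' hf := DifferentiableOn.neg hf

/-- Riemann's theta function `θ(x, τ) = ∑ₙ exp(πi n² τ + 2πi n x)`. -/
def theta (p : ℂ × ℍ) : ℂ := jacobiTheta₂ p.1 p.2

/-- Appell's function
`κ(y, x, τ) = ∑ₙ exp(πi τ n² + 2πi n x) / (exp(2πi n τ) - exp(2πi y))`. -/
def kappa (y x : ℂ) (τ : ℍ) : ℂ :=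
  ∑' n : ℤ, cexp (π * I * τ * (n : ℂ) ^ 2 + 2 * π * I * n * x) /
    (cexp (2 * π * I * n * τ) - cexp (2 * π * I * y))

/-- `κ((τ + 1)/2, x, τ)`. -/
def kappaHalf (p : ℂ × ℍ) : ℂ := kappa (((p.2 : ℂ) + 1) / 2) p.1 p.2

/-- `κ₀(x, τ) = exp(3πiτ/4) κ((τ + 1)/2, x, τ)`. -/
def kappa0 (p : ℂ × ℍ) : ℂ := cexp (3 * π * I * p.2 / 4) * kappaHalf p

/-- The number `z` is the multiplier of `γ` in the theta transformation law
`θ(x/(cτ+d), γτ) = z (cτ+d)^{1/2} exp(πi c x²/(cτ+d)) θ(x, τ)`,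
with the principal branch of the square root. -/
def IsThetaMultiplier (γ : Gamma12) (z : ℂ) : Prop :=
  ∀ (x : ℂ) (τ : ℍ),
    theta (x / autFactor γ τ, (γ : SL(2, ℤ)) • τ) =
      z * autFactor γ τ ^ (1 / 2 : ℂ) * cexp (π * I * ec γ * x ^ 2 / autFactor γ τ) *
        theta (x, τ)

/-- The explicit value of `ζ(γ)²`. -/
def zetaSq (γ : Gamma12) : ℂ :=
  if Odd (ed γ) then (-1 : ℂ) ^ ((ed γ - 1) / 2) else cexp (-(π * I * ec γ / 2))

/-- The character `χ`; if `a` is odd then `c` is even, so the integer divisions are exact. -/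
def chi (γ : Gamma12) : ℂ :=
  if Even (ea γ) then
    (-1 : ℂ) ^ (ea γ / 2) * cexp (π * I / 4 * ((ea γ * eb γ + ec γ * ed γ : ℤ) : ℂ))
  else
    (-1 : ℂ) ^ (ec γ / 2) * cexp (π * I / 4 * ((ea γ * eb γ + ec γ * ed γ : ℤ) : ℂ))

/-- The factor `exp(πi (1/(cτ+d) - 1) x)`. -/
def etaFactor (γ : Gamma12) (p : ℂ × ℍ) : ℂ :=
  cexp (π * I * (1 / autFactor γ p.2 - 1) * p.1)

/-- `exp(3πi/4 (τ - γτ)) z⁻² χ(γ)⁻¹ (cτ+d)`. -/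
def kFactor (z : ℂ) (γ : Gamma12) (τ : ℍ) : ℂ :=
  cexp (3 * π * I / 4 * ((τ : ℂ) - (((γ : SL(2, ℤ)) • τ : ℍ) : ℂ))) *
    (z ^ 2)⁻¹ * (chi γ)⁻¹ * autFactor γ τ

/-- `κ₀(x/(cτ+d), γτ) - z⁻² χ(γ)⁻¹ (cτ+d) exp(πi (1/(cτ+d) - 1) x) κ₀(x, τ)`
as a function of `(x, τ)`. -/
def kappaDefect (z : ℂ) (γ : Gamma12) (p : ℂ × ℍ) : ℂ :=
  kappa0 (p.1 / autFactor γ p.2, (γ : SL(2, ℤ)) • p.2) -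
    (z ^ 2)⁻¹ * (chi γ)⁻¹ * autFactor γ p.2 * etaFactor γ p * kappa0 p

/-- A 1-cocycle of `G` with values in holomorphic maps `ℂ × ℍ → GL₂(ℂ)`, that is, a rank-two
bundle on the universal elliptic curve with a trivialization of its pull-back to `ℂ × ℍ`. -/
structure IsCocycle (C : UnivGroup → ℂ × ℍ → GL (Fin 2) ℂ) : Prop where
  holo : ∀ g i j, IsHolo (fun p => (C g p : Matrix (Fin 2) (Fin 2) ℂ) i j)
  mul : ∀ g h p, C (g * h) p = C g (h • p) * C h p

/-- `s` is a global holomorphic section of the bundle given by the cocycle `C`. -/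
structure IsSection (C : UnivGroup → ℂ × ℍ → GL (Fin 2) ℂ) (s : ℂ × ℍ → Fin 2 → ℂ) : Prop where
  holo : ∀ i, IsHolo (fun p => s p i)
  equivariant : ∀ g p, s (g • p) = (C g p : Matrix (Fin 2) (Fin 2) ℂ) *ᵥ s p

/-- The bundle given by `C` is an extension of the theta line bundle by the twist, by the functions
`k_γ(τ) = exp(3πi/4 (τ - γτ)) ζ(γ)⁻² χ(γ)⁻¹ (cτ+d)` on `ℍ`, of the line bundle of order two attached to `(τ + 1)/2`, and on
each elliptic curve it is the extension with matrix
`(exp(πi(τ+1)) 1; 0 exp(-πiτ-2πix))` for the translation `x ↦ x + τ`. -/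
structure IsThetaExtension (ζ : Gamma12 → ℂ)
    (C : UnivGroup → ℂ × ℍ → GL (Fin 2) ℂ) : Prop where
  transl_form : ∀ (m n : ℤ) (x : ℂ) (τ : ℍ), ∃ u : ℂ,
    (C (transl m n) (x, τ) : Matrix (Fin 2) (Fin 2) ℂ) =
      !![cexp (π * I * n * (τ + 1)), u;
         0, cexp (-(π * I * (n : ℂ) ^ 2 * τ) - 2 * π * I * n * x)]
  transl_one : ∀ p, C (transl 1 0) p = 1
  transl_tau : ∀ (x : ℂ) (τ : ℍ),
    (C (transl 0 1) (x, τ) : Matrix (Fin 2) (Fin 2) ℂ) =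
      !![cexp (π * I * (τ + 1)), 1; 0, cexp (-(π * I * τ) - 2 * π * I * x)]
  modular_form : ∀ (γ : Gamma12) (x : ℂ) (τ : ℍ), ∃ u : ℂ,
    (C (modular γ) (x, τ) : Matrix (Fin 2) (Fin 2) ℂ) =
      !![kFactor (ζ γ) γ τ * etaFactor γ (x, τ), u;
         0, ζ γ * autFactor γ τ ^ (1 / 2 : ℂ) *
          cexp (π * I * ec γ * x ^ 2 / autFactor γ τ)]

end AppellKappa

end

noncomputable section

namespace AppellKappa

/-! Everything is a question about cocycles of the group G, and a cocycle statement need only be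
tested on generators: the translations (1,0) and (0,1), S = (0 -1; 1 0) and T² = (1 2; 0 1). The
last two generate the theta group, by a Euclidean descent on |c| (`closure_generators`).

Diagonal entries. For the theta function only the square of the multiplier is followed through the
group, where no branch of a root occurs. The quotient of the multiplier by the principal-branch
factor then has constant square on the connected space ℂ × ℍ, so it is a constant ζ(γ)
(`exists_isThetaMultiplier`). The multiplier of κ is the coboundary of exp(πix - 3πiτ/4) times a
character times cτ+d (`twistMult_eq`).

Off-diagonal entry. The elements g for which κ(gp) minus its multiplier times κ(p) is a holomorphic
multiple bθ form a subgroup. For both translations and T² this is read off the series. For S the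
multiple involves the Mordell integral h (`appellM_inversion`): with M = exp(3πiτ/4 - πix) κ, the
function M(x/τ, -1/τ) - iτ M(x,τ) + (iτ/2) h(x,τ) θ(x,τ) is entire in x and changes sign under x ↦
x+1 and x ↦ x+τ, because the theta terms in the translation laws of M and of h cancel. Its modulus
is doubly periodic, so by Liouville it is a constant equal to its own negative, that is, zero. The
laws for h come from a Gaussian integral and from moving the contour to Im w = 1.

Since θ(·,τ) vanishes identically for no τ, the entry b is unique (`eq_of_mul_theta_eq`). Uniqueness
gives the cocycle rule of the matrices, and part (2) is the equation defining b for g = γ,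
multiplied by exp(3πiγτ/4). -/

/-! ### Eighth roots of unity and the two characters of the theta group -/

/-- The eighth root of unity `exp(πik/4)`. -/
def eighthRoot (k : ℤ) : ℂ := cexp (π * I / 4 * (k : ℂ))

theorem eighthRoot_add (k l : ℤ) : eighthRoot (k + l) = eighthRoot k * eighthRoot l := by
  simp only [eighthRoot, ← Complex.exp_add]
  congr 1
  push_cast
  ring

theorem eighthRoot_eight_mul (k : ℤ) : eighthRoot (8 * k) = 1 := by
  rw [eighthRoot, Complex.exp_eq_one_iff]
  exact ⟨k, by push_cast; ring⟩

theorem eighthRoot_congr {k l : ℤ} (m : ℤ) (h : k = l + 8 * m) : eighthRoot k = eighthRoot l := by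
  rw [h, eighthRoot_add, eighthRoot_eight_mul, mul_one]

theorem eighthRoot_zero : eighthRoot 0 = 1 := by simp [eighthRoot]

theorem eighthRoot_four_mul (k : ℤ) : eighthRoot (4 * k) = (-1 : ℂ) ^ k := by
  rw [eighthRoot, ← Complex.exp_pi_mul_I, ← Complex.exp_int_mul]
  congr 1
  push_cast
  ring

theorem eighthRoot_pow_four {k l : ℤ} (h : k = 2 * l) : eighthRoot k ^ 4 = 1 := by
  rw [eighthRoot, ← Complex.exp_nat_mul, Complex.exp_eq_one_iff]
  exact ⟨l, by rw [h]; push_cast; ring⟩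

/-- An element of the theta group is congruent to `1` or to `(0 1; 1 0)` modulo `2`. -/
theorem entries_parity (γ : Gamma12) :
    (∃ p q r s : ℤ, ea γ = 2 * p + 1 ∧ eb γ = 2 * q ∧ ec γ = 2 * r ∧ ed γ = 2 * s + 1) ∨
    (∃ p q r s : ℤ, ea γ = 2 * p ∧ eb γ = 2 * q + 1 ∧ ec γ = 2 * r + 1 ∧ ed γ = 2 * s) := by
  have h1 : Even (ea γ * ec γ) := even_iff_two_dvd.2 γ.2.1
  have h2 : Even (eb γ * ed γ) := even_iff_two_dvd.2 γ.2.2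
  have h3 : Odd (ea γ * ed γ - eb γ * ec γ) := by rw [det_eq]; exact odd_one
  rw [Int.even_mul] at h1 h2
  rw [Int.odd_sub, Int.odd_mul, Int.even_mul] at h3
  simp only [← Int.not_even_iff_odd] at h3
  by_cases ha : Even (ea γ)
  · right
    have hc : ¬ Even (ec γ) := by tauto
    have hb : ¬ Even (eb γ) := by tauto
    have hd : Even (ed γ) := by tauto
    obtain ⟨p, hp⟩ := even_iff_two_dvd.1 ha
    obtain ⟨s, hs⟩ := even_iff_two_dvd.1 hd
    obtain ⟨q, hq⟩ := Int.not_even_iff_odd.1 hb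
    obtain ⟨r, hr⟩ := Int.not_even_iff_odd.1 hc
    exact ⟨p, q, r, s, hp, hq, hr, hs⟩
  · left
    have hc : Even (ec γ) := by tauto
    have hd : ¬ Even (ed γ) := by tauto
    have hb : Even (eb γ) := by tauto
    obtain ⟨p, hp⟩ := Int.not_even_iff_odd.1 ha
    obtain ⟨s, hs⟩ := Int.not_even_iff_odd.1 hd
    obtain ⟨q, hq⟩ := even_iff_two_dvd.1 hb
    obtain ⟨r, hr⟩ := even_iff_two_dvd.1 hc
    exact ⟨p, q, r, s, hp, hq, hr, hs⟩

/-- Writing `chi` and `zetaSq` as powers of exp(πi/4) reduces their multiplicativity to congruences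
modulo 8 between integer polynomials in the halved entries. -/
theorem chi_of_even {γ : Gamma12} {p : ℤ} (h : ea γ = 2 * p) :
    chi γ = eighthRoot (4 * p + (ea γ * eb γ + ec γ * ed γ)) := by
  have he : Even (ea γ) := even_iff_two_dvd.2 ⟨p, h⟩
  rw [chi, if_pos he, eighthRoot_add, eighthRoot_four_mul, h,
    Int.mul_ediv_cancel_left _ two_ne_zero]
  rfl

theorem chi_of_odd {γ : Gamma12} {p r : ℤ} (h : ea γ = 2 * p + 1) (hc : ec γ = 2 * r) :
    chi γ = eighthRoot (4 * r + (ea γ * eb γ + ec γ * ed γ)) := by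
  have he : ¬ Even (ea γ) := Int.not_even_iff_odd.2 ⟨p, h⟩
  rw [chi, if_neg he, eighthRoot_add, eighthRoot_four_mul, hc,
    Int.mul_ediv_cancel_left _ two_ne_zero]
  rfl

theorem zetaSq_of_odd {γ : Gamma12} {s : ℤ} (h : ed γ = 2 * s + 1) :
    zetaSq γ = eighthRoot (4 * s) := by
  rw [zetaSq, if_pos ⟨s, h⟩, eighthRoot_four_mul, h, add_sub_cancel_right,
    Int.mul_ediv_cancel_left _ two_ne_zero]

theorem zetaSq_of_even {γ : Gamma12} {s : ℤ} (h : ed γ = 2 * s) :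
    zetaSq γ = eighthRoot (-2 * ec γ) := by
  have he : ¬ Odd (ed γ) := Int.not_odd_iff_even.2 (even_iff_two_dvd.2 ⟨s, h⟩)
  rw [zetaSq, if_neg he, eighthRoot]
  congr 1
  push_cast
  ring

/-! ### Generators of the theta group -/

/-- The element `(0 -1; 1 0)` of the theta group. -/
def inversion : Gamma12 := ⟨ModularGroup.S, by
  change 2 ∣ ModularGroup.S 0 0 * ModularGroup.S 1 0 ∧ 2 ∣ ModularGroup.S 0 1 * ModularGroup.S 1 1
  simp [ModularGroup.S]⟩

/-- The element `(1 2; 0 1)` of the theta group. -/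
def shiftTwo : Gamma12 := ⟨⟨!![1, 2; 0, 1], by simp [Matrix.det_fin_two]⟩, by
  change 2 ∣ (1 : ℤ) * 0 ∧ 2 ∣ (2 : ℤ) * 1
  simp⟩

theorem entries_one : ea 1 = 1 ∧ eb 1 = 0 ∧ ec 1 = 0 ∧ ed 1 = 1 := by
  simp [ea, eb, ec, ed]

theorem entries_inversion :
    ea inversion = 0 ∧ eb inversion = -1 ∧ ec inversion = 1 ∧ ed inversion = 0 := by
  simp [ea, eb, ec, ed, inversion, ModularGroup.S]

theorem entries_shiftTwo :
    ea shiftTwo = 1 ∧ eb shiftTwo = 2 ∧ ec shiftTwo = 0 ∧ ed shiftTwo = 1 := by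
  simp [ea, eb, ec, ed, shiftTwo]

theorem entries_mul_inversion (γ : Gamma12) :
    ea (γ * inversion) = eb γ ∧ eb (γ * inversion) = -ea γ ∧
    ec (γ * inversion) = ed γ ∧ ed (γ * inversion) = -ec γ := by
  obtain ⟨h1, h2, h3, h4⟩ := entries_mul γ inversion
  obtain ⟨s1, s2, s3, s4⟩ := entries_inversion
  rw [h1, h2, h3, h4, s1, s2, s3, s4]
  simp

theorem entries_mul_shiftTwo (γ : Gamma12) :
    ea (γ * shiftTwo) = ea γ ∧ eb (γ * shiftTwo) = 2 * ea γ + eb γ ∧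
    ec (γ * shiftTwo) = ec γ ∧ ed (γ * shiftTwo) = 2 * ec γ + ed γ := by
  obtain ⟨h1, h2, h3, h4⟩ := entries_mul γ shiftTwo
  obtain ⟨s1, s2, s3, s4⟩ := entries_shiftTwo
  rw [h1, h2, h3, h4, s1, s2, s3, s4]
  refine ⟨by ring, by ring, by ring, by ring⟩

theorem Gamma12_ext {γ δ : Gamma12} (h1 : ea γ = ea δ) (h2 : eb γ = eb δ) (h3 : ec γ = ec δ)
    (h4 : ed γ = ed δ) : γ = δ := by
  apply Subtype.ext
  apply Matrix.SpecialLinearGroup.ext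
  intro i j
  fin_cases i <;> fin_cases j
  · exact h1
  · exact h2
  · exact h3
  · exact h4

theorem entries_shiftTwo_zpow (k : ℤ) : ea (shiftTwo ^ k) = 1 ∧ eb (shiftTwo ^ k) = 2 * k ∧
    ec (shiftTwo ^ k) = 0 ∧ ed (shiftTwo ^ k) = 1 := by
  induction k using Int.induction_on with
  | zero => simpa using entries_one
  | succ k ih =>
    obtain ⟨h1, h2, h3, h4⟩ := entries_mul_shiftTwo (shiftTwo ^ (k : ℤ))
    rw [zpow_add_one, h1, h2, h3, h4, ih.1, ih.2.1, ih.2.2.1, ih.2.2.2]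
    refine ⟨rfl, by ring, rfl, by ring⟩
  | pred k ih =>
    obtain ⟨h1, h2, h3, h4⟩ := entries_mul_shiftTwo (shiftTwo ^ (-(k : ℤ) - 1))
    rw [← zpow_add_one, sub_add_cancel, ih.1, ih.2.1, ih.2.2.1, ih.2.2.2] at *
    refine ⟨h1.symm, by omega, h3.symm, by omega⟩

/-- The theta group is generated by `(0 -1; 1 0)` and `(1 2; 0 1)`. -/
theorem closure_generators : Subgroup.closure {inversion, shiftTwo} = (⊤ : Subgroup Gamma12) := by
  set K := Subgroup.closure {inversion, shiftTwo} with hK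
  have hS : inversion ∈ K := Subgroup.subset_closure (by simp)
  have hT : shiftTwo ∈ K := Subgroup.subset_closure (by simp)
  -- Descent on |c|: right multiplication by a power of T² changes d by a multiple of 2c, making |d|
  -- < |c|, and S then moves d into the place of c.
  have key : ∀ (n : ℕ) (γ : Gamma12), (ec γ).natAbs ≤ n → γ ∈ K := by
    intro n
    induction n with
    | zero =>
      intro γ h
      have hc : ec γ = 0 := by omega
      have hdet := det_eq γ
      rw [hc, mul_zero, sub_zero] at hdet
      rcases entries_parity γ with ⟨p, q, r, s, ha, hb, -, hd⟩ | ⟨p, q, r, s, -, -, hc', -⟩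
      · obtain ⟨t1, t2, t3, t4⟩ := entries_shiftTwo_zpow q
        obtain ⟨u1, u2, u3, u4⟩ := entries_shiftTwo_zpow (-q)
        rcases Int.mul_eq_one_iff_eq_one_or_neg_one.1 hdet with ⟨ha1, hd1⟩ | ⟨ha1, hd1⟩
        · have : γ = shiftTwo ^ q := by
            apply Gamma12_ext <;> simp only [t1, t2, t3, t4, ha1, hb, hc, hd1]
          rw [this]
          exact K.zpow_mem hT q
        -- Here γ is minus a power of T², and -1 is the square of S.
        · have : γ = shiftTwo ^ (-q) * inversion * inversion := by
            obtain ⟨e1, e2, e3, e4⟩ := entries_mul_inversion (shiftTwo ^ (-q) * inversion)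
            obtain ⟨f1, f2, f3, f4⟩ := entries_mul_inversion (shiftTwo ^ (-q))
            apply Gamma12_ext
            · rw [e1, f2, u1, ha1]
            · rw [e2, f1, u2, hb]; ring
            · rw [e3, f4, u3, hc]; ring
            · rw [e4, f3, u4, hd1]
          rw [this]
          exact K.mul_mem (K.mul_mem (K.zpow_mem hT _) hS) hS
      · omega
    | succ n ih =>
      intro γ h
      by_cases hle : (ec γ).natAbs ≤ n
      · exact ih γ hle
      have hc0 : ec γ ≠ 0 := by intro h0; simp [h0] at hle
      obtain ⟨k, hk⟩ : ∃ k : ℤ, (ed γ + 2 * k * ec γ).natAbs < (ec γ).natAbs := by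
        -- Centred division of d by 2|c|: w - |c| lies in [-|c|, |c|) and is congruent to d modulo
        -- 2c.
        have hpos : 0 < |ec γ| := abs_pos.2 hc0
        have h1 := Int.emod_nonneg (ed γ + |ec γ|) (show 2 * |ec γ| ≠ 0 by omega)
        have h2 := Int.emod_lt_of_pos (ed γ + |ec γ|) (show 0 < 2 * |ec γ| by omega)
        have h3 := Int.emod_add_mul_ediv (ed γ + |ec γ|) (2 * |ec γ|)
        set w := (ed γ + |ec γ|) % (2 * |ec γ|)
        set q := (ed γ + |ec γ|) / (2 * |ec γ|)
        have h4 : w - |ec γ| = ed γ - 2 * q * |ec γ| := by linarith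
        obtain ⟨k, hk⟩ : ∃ k : ℤ, w - |ec γ| = ed γ + 2 * k * ec γ := by
          rcases abs_choice (ec γ) with habs | habs
          · exact ⟨-q, by rw [h4]; nth_rewrite 1 [habs]; ring⟩
          · exact ⟨q, by rw [h4]; nth_rewrite 1 [habs]; ring⟩
        refine ⟨k, ?_⟩
        have habs := abs_choice (ec γ)
        clear_value w q
        generalize |ec γ| = e at *
        -- The endpoint -|c| is excluded because c and d have opposite parity; this makes the
        -- descent strict.
        have h0 : w ≠ 0 := by
          intro hw
          rw [hw] at hk
          rcases entries_parity γ with ⟨_, _, r, s, -, -, hc, hd⟩ | ⟨_, _, r, s, -, -, hc, hd⟩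
          · have : 2 * (k * ec γ) = 2 * k * ec γ := by ring
            omega
          · have : 2 * (k * ec γ) = 2 * k * ec γ := by ring
            omega
        rw [← hk]
        omega
      obtain ⟨t1, t2, t3, t4⟩ := entries_shiftTwo_zpow k
      obtain ⟨-, -, m3, m4⟩ := entries_mul γ (shiftTwo ^ k)
      obtain ⟨-, -, e3, -⟩ := entries_mul_inversion (γ * shiftTwo ^ k)
      have hmem : γ * shiftTwo ^ k * inversion ∈ K := by
        apply ih
        rw [e3, m4, t2, t4, show ec γ * (2 * k) + ed γ * 1 = ed γ + 2 * k * ec γ by ring]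
        omega
      rw [K.mul_mem_cancel_right hS, K.mul_mem_cancel_right (K.zpow_mem hT k)] at hmem
      exact hmem
  exact (Subgroup.eq_top_iff' K).2 fun γ => key _ γ le_rfl

/-- A function that is multiplicative for right multiplication by generators is multiplicative. -/
theorem map_mul_of_closure {G : Type*} [Group G] {s : Set G} (hs : Subgroup.closure s = ⊤)
    {f : G → ℂ} (h1 : f 1 = 1) (hf : ∀ g, ∀ t ∈ s, f (g * t) = f g * f t) (g h : G) :
    f (g * h) = f g * f h := by
  have hh : h ∈ Subgroup.closure s := hs ▸ Subgroup.mem_top h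
  induction hh using Subgroup.closure_induction generalizing g with
  | mem t ht => exact hf g t ht
  | one => rw [mul_one, h1, mul_one]
  | mul x y _ _ hx hy => rw [← mul_assoc, hy, hx, hy x, mul_assoc]
  | inv x _ hx =>
    have e1 := hx (g * x⁻¹)
    have e2 := hx x⁻¹
    rw [inv_mul_cancel_right] at e1
    rw [inv_mul_cancel, h1] at e2
    rw [e1, mul_assoc, mul_comm (f x), ← e2, mul_one]

/-! ### Multiplicativity and orders of χ and ζ² -/

theorem chi_one : chi 1 = 1 := by
  obtain ⟨h1, h2, h3, h4⟩ := entries_one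
  rw [chi_of_odd (p := 0) (r := 0) (by rw [h1]; rfl) (by rw [h3]; rfl), h1, h2, h3, h4]
  exact eighthRoot_zero

theorem zetaSq_one : zetaSq 1 = 1 := by
  obtain ⟨h1, h2, h3, h4⟩ := entries_one
  rw [zetaSq_of_odd (s := 0) (by rw [h4]; rfl)]
  exact eighthRoot_zero

theorem chi_inversion : chi inversion = 1 := by
  obtain ⟨h1, h2, h3, h4⟩ := entries_inversion
  rw [chi_of_even (p := 0) (by rw [h1]; rfl), h1, h2, h3, h4]
  exact eighthRoot_zero

theorem zetaSq_inversion : zetaSq inversion = eighthRoot (-2) := by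
  obtain ⟨h1, h2, h3, h4⟩ := entries_inversion
  rw [zetaSq_of_even (s := 0) (by rw [h4]; rfl), h3]
  rfl

theorem chi_shiftTwo : chi shiftTwo = eighthRoot 2 := by
  obtain ⟨h1, h2, h3, h4⟩ := entries_shiftTwo
  rw [chi_of_odd (p := 0) (r := 0) (by rw [h1]; rfl) (by rw [h3]; rfl), h1, h2, h3, h4]
  rfl

theorem zetaSq_shiftTwo : zetaSq shiftTwo = 1 := by
  obtain ⟨h1, h2, h3, h4⟩ := entries_shiftTwo
  rw [zetaSq_of_odd (s := 0) (by rw [h4]; rfl)]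
  exact eighthRoot_zero

theorem chi_mul (γ δ : Gamma12) : chi (γ * δ) = chi γ * chi δ := by
  refine map_mul_of_closure closure_generators chi_one ?_ γ δ
  rintro γ t (rfl | rfl)
  · obtain ⟨e1, e2, e3, e4⟩ := entries_mul_inversion γ
    rw [chi_inversion, mul_one]
    rcases entries_parity γ with ⟨p, q, r, s, ha, hb, hc, hd⟩ | ⟨p, q, r, s, ha, hb, hc, hd⟩
    · rw [chi_of_odd ha hc, chi_of_even (e1.trans hb), e1, e2, e3, e4, ha, hb, hc, hd]
      exact eighthRoot_congr (-(r + p * q + r * s)) (by ring)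
    · rw [chi_of_even ha, chi_of_odd (e1.trans hb) (e3.trans hd), e1, e2, e3, e4, ha, hb, hc, hd]
      exact eighthRoot_congr (-(p + p * q + r * s)) (by ring)
  · obtain ⟨e1, e2, e3, e4⟩ := entries_mul_shiftTwo γ
    rw [chi_shiftTwo]
    rcases entries_parity γ with ⟨p, q, r, s, ha, hb, hc, hd⟩ | ⟨p, q, r, s, ha, hb, hc, hd⟩
    · rw [chi_of_odd ha hc, chi_of_odd (e1.trans ha) (e3.trans hc), e1, e2, e3, e4, ha, hb, hc, hd,
        ← eighthRoot_add]
      exact eighthRoot_congr (p ^ 2 + p + r ^ 2) (by ring)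
    · rw [chi_of_even ha, chi_of_even (e1.trans ha), e1, e2, e3, e4, ha, hb, hc, hd,
        ← eighthRoot_add]
      exact eighthRoot_congr (p ^ 2 + r + r ^ 2) (by ring)

theorem zetaSq_mul (γ δ : Gamma12) : zetaSq (γ * δ) = zetaSq γ * zetaSq δ := by
  refine map_mul_of_closure closure_generators zetaSq_one ?_ γ δ
  rintro γ t (rfl | rfl)
  · obtain ⟨e1, e2, e3, e4⟩ := entries_mul_inversion γ
    rw [zetaSq_inversion]
    rcases entries_parity γ with ⟨p, q, r, s, ha, hb, hc, hd⟩ | ⟨p, q, r, s, ha, hb, hc, hd⟩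
    · rw [zetaSq_of_odd hd, zetaSq_of_even (s := -r) (by rw [e4, hc]; ring), e3, hd,
        ← eighthRoot_add]
      exact eighthRoot_congr (-s) (by ring)
    · rw [zetaSq_of_even hd, zetaSq_of_odd (s := -r - 1) (by rw [e4, hc]; ring), hc,
        ← eighthRoot_add]
      exact eighthRoot_congr 0 (by ring)
  · obtain ⟨e1, e2, e3, e4⟩ := entries_mul_shiftTwo γ
    rw [zetaSq_shiftTwo, mul_one]
    rcases entries_parity γ with ⟨p, q, r, s, ha, hb, hc, hd⟩ | ⟨p, q, r, s, ha, hb, hc, hd⟩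
    · rw [zetaSq_of_odd hd, zetaSq_of_odd (s := 2 * r + s) (by rw [e4, hc, hd]; ring)]
      exact eighthRoot_congr r (by ring)
    · rw [zetaSq_of_even hd, zetaSq_of_even (s := 2 * r + 1 + s) (by rw [e4, hc, hd]; ring), e3]

theorem chi_pow_four (γ : Gamma12) : chi γ ^ 4 = 1 := by
  rcases entries_parity γ with ⟨p, q, r, s, ha, hb, hc, hd⟩ | ⟨p, q, r, s, ha, hb, hc, hd⟩
  · rw [chi_of_odd ha hc, ha, hb, hc, hd]
    exact eighthRoot_pow_four (l := 2 * r + (2 * p + 1) * q + r * (2 * s + 1)) (by ring)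
  · rw [chi_of_even ha, ha, hb, hc, hd]
    exact eighthRoot_pow_four (l := 2 * p + p * (2 * q + 1) + (2 * r + 1) * s) (by ring)

theorem zetaSq_pow_four (γ : Gamma12) : zetaSq γ ^ 4 = 1 := by
  rcases entries_parity γ with ⟨p, q, r, s, ha, hb, hc, hd⟩ | ⟨p, q, r, s, ha, hb, hc, hd⟩
  · rw [zetaSq_of_odd hd]
    exact eighthRoot_pow_four (l := 2 * s) (by ring)
  · rw [zetaSq_of_even hd]
    exact eighthRoot_pow_four (l := -ec γ) (by ring)

theorem chi_ne_zero (γ : Gamma12) : chi γ ≠ 0 := fun h => by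
  have := chi_pow_four γ
  simp [h] at this

theorem zetaSq_ne_zero (γ : Gamma12) : zetaSq γ ≠ 0 := fun h => by
  have := zetaSq_pow_four γ
  simp [h] at this

/-! ### Holomorphic dependence of integrals and series on parameters -/

open MeasureTheory Metric in
/-- A locally dominated integral of holomorphic functions is complex differentiable. -/
theorem differentiableAt_integral_of_norm_le {α E : Type*} [MeasurableSpace α] {μ : Measure α}
    [NormedAddCommGroup E] [NormedSpace ℂ E] {F : E → α → ℂ} {F' : α → E →L[ℂ] ℂ} {b : α → ℝ}
    {x₀ : E} {r : ℝ} (hr : 0 < r) (hmeas : ∀ x ∈ ball x₀ r, AEStronglyMeasurable (F x) μ)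
    (hmeas' : AEStronglyMeasurable F' μ) (hd : ∀ a, DifferentiableOn ℂ (F · a) (ball x₀ r))
    (hd' : ∀ a, HasFDerivAt (F · a) (F' a) x₀) (hb : ∀ a, ∀ x ∈ ball x₀ r, ‖F x a‖ ≤ b a)
    (hint : Integrable b μ) : DifferentiableAt ℂ (fun x => ∫ a, F x a ∂μ) x₀ := by
  have hx₀ : x₀ ∈ ball x₀ r := mem_ball_self hr
  -- The Lipschitz constant 2b/r comes from the Schwarz lemma: each integrand maps the ball of
  -- radius r into a ball of radius 2b about its central value. No bound on derivatives is needed.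
  have key := hasFDerivAt_integral_of_dominated_loc_of_lip' (𝕜 := ℂ)
    (bound := fun a => 2 * b a / r) (ball_mem_nhds x₀ hr) hmeas
    (hint.mono' (hmeas _ hx₀) (Filter.Eventually.of_forall fun a => hb a _ hx₀)) hmeas' ?_
    ((hint.const_mul 2).div_const r) (Filter.Eventually.of_forall hd')
  · exact key.2.differentiableAt
  · refine Filter.Eventually.of_forall fun a x hx => ?_
    rw [← dist_eq_norm, ← dist_eq_norm]
    refine Complex.dist_le_div_mul_dist_of_mapsTo_ball (hd a) (fun y hy => ?_) hx
    rw [mem_closedBall, dist_eq_norm]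
    linarith [norm_sub_le (F y a) (F x₀ a), hb a y hy, hb a _ hx₀]

open MeasureTheory Metric in
/-- A locally normally convergent series of holomorphic functions is complex differentiable. -/
theorem differentiableAt_tsum_of_norm_le {E : Type*} [NormedAddCommGroup E] [NormedSpace ℂ E]
    {F : E → ℤ → ℂ} {b : ℤ → ℝ} {x₀ : E} {r : ℝ} (hr : 0 < r)
    (hd : ∀ n, DifferentiableOn ℂ (F · n) (ball x₀ r))
    (hb : ∀ n, ∀ x ∈ ball x₀ r, ‖F x n‖ ≤ b n) (hs : Summable b) :
    DifferentiableAt ℂ (fun x => ∑' n, F x n) x₀ := by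
  have hint : Integrable b Measure.count := integrable_count_iff.2 hs.norm
  have := differentiableAt_integral_of_norm_le (μ := Measure.count) (F := F) hr
    (fun x _ => AEStronglyMeasurable.of_discrete) AEStronglyMeasurable.of_discrete hd
    (fun n => ((hd n).differentiableAt (ball_mem_nhds x₀ hr)).hasFDerivAt) hb hint
  refine this.congr_of_eventuallyEq ?_
  filter_upwards [ball_mem_nhds x₀ hr] with x hx
  rw [integral_countable (hint.mono' AEStronglyMeasurable.of_discrete
    (Filter.Eventually.of_forall fun n => hb n x hx))]
  simp [Measure.real]

/-! ### Convergence and holomorphy of Appell's series -/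

/-- The function `κ((τ + 1)/2, x, τ)` on `ℂ × ℂ`. -/
def kappaSeries (x τ : ℂ) : ℂ :=
  ∑' n : ℤ, cexp (π * I * τ * (n : ℂ) ^ 2 + 2 * π * I * n * x) /
    (cexp (2 * π * I * n * τ) - cexp (2 * π * I * ((τ + 1) / 2)))

theorem kappaHalf_eq (p : ℂ × ℍ) : kappaHalf p = kappaSeries p.1 p.2 := rfl

theorem exp_half_period (τ : ℂ) :
    cexp (2 * π * I * ((τ + 1) / 2)) = -cexp (π * I * τ) := by
  rw [show 2 * π * I * ((τ + 1) / 2) = π * I * τ + π * I by ring, Complex.exp_add,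
    Complex.exp_pi_mul_I, mul_neg_one]

theorem norm_exp_pi_I_mul (k : ℝ) (τ : ℂ) : ‖cexp (π * I * k * τ)‖ = rexp (-(π * k * τ.im)) := by
  rw [Complex.norm_exp]
  congr 1
  simp

/-- The two exponentials have well separated moduli: |exp(πiτ)| = exp(-π Im τ) < 1, while
|exp(2πinτ)| is at least 1 for n ≤ 0 and at most |exp(πiτ)|² for n ≥ 1. The bound is uniform in n,
so the series converges like the theta series. -/
theorem le_norm_kappaDenominator {T U : ℝ} {τ : ℂ} (hT : 0 < T) (h1 : T ≤ τ.im) (h2 : τ.im ≤ U)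
    (n : ℤ) : rexp (-(π * U)) * (1 - rexp (-(π * T))) ≤
      ‖cexp (2 * π * I * n * τ) - cexp (2 * π * I * ((τ + 1) / 2))‖ := by
  have e1 := norm_exp_pi_I_mul (2 * n) τ
  have e2 := norm_exp_pi_I_mul 1 τ
  rw [show (π * I * ((2 * n : ℝ) : ℂ) * τ : ℂ) = 2 * π * I * n * τ by push_cast; ring] at e1
  rw [show (π * I * ((1 : ℝ) : ℂ) * τ : ℂ) = π * I * τ by push_cast; ring] at e2
  rw [exp_half_period, sub_neg_eq_add]
  have hπ := Real.pi_pos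
  have hlt : rexp (-(π * T)) < 1 := by rw [Real.exp_lt_one_iff]; nlinarith
  have hle : rexp (-(π * τ.im)) ≤ rexp (-(π * T)) := Real.exp_le_exp.2 (by nlinarith)
  rcases le_or_gt n 0 with hn | hn
  · have hn' : (n : ℝ) ≤ 0 := by exact_mod_cast hn
    have h3 := norm_sub_norm_le (cexp (2 * π * I * n * τ)) (-cexp (π * I * τ))
    rw [sub_neg_eq_add, norm_neg, e1, e2] at h3
    have h4 : 1 ≤ rexp (-(π * (2 * n) * τ.im)) := by
      rw [Real.one_le_exp_iff]
      have : 0 ≤ π * τ.im * (-n) := by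
        apply mul_nonneg _ (by linarith)
        nlinarith
      nlinarith
    have h5 : rexp (-(π * U)) ≤ 1 := by rw [Real.exp_le_one_iff]; nlinarith
    have h6 : rexp (-(π * U)) * (1 - rexp (-(π * T))) ≤ 1 * (1 - rexp (-(π * T))) :=
      mul_le_mul_of_nonneg_right h5 (by linarith)
    rw [mul_one] at h3
    linarith
  · have hn' : (1 : ℝ) ≤ n := by exact_mod_cast hn
    have h3 := norm_sub_norm_le (cexp (π * I * τ)) (-cexp (2 * π * I * n * τ))
    rw [sub_neg_eq_add, norm_neg, e1, e2, add_comm] at h3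
    have h4 : rexp (-(π * (2 * n) * τ.im)) ≤ rexp (-(π * τ.im)) * rexp (-(π * τ.im)) := by
      rw [← Real.exp_add, Real.exp_le_exp]
      have : 0 ≤ π * τ.im * (n - 1) := by
        apply mul_nonneg _ (by linarith)
        nlinarith
      nlinarith
    have h5 : rexp (-(π * U)) ≤ rexp (-(π * τ.im)) := Real.exp_le_exp.2 (by nlinarith)
    rw [mul_one] at h3
    calc _ ≤ rexp (-(π * τ.im)) * (1 - rexp (-(π * T))) :=
          mul_le_mul_of_nonneg_right h5 (by linarith)
      _ ≤ rexp (-(π * τ.im)) * (1 - rexp (-(π * τ.im))) := by gcongr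
      _ ≤ _ := by linarith

theorem kappaDenominator_ne_zero {τ : ℂ} (hτ : 0 < τ.im) (n : ℤ) :
    cexp (2 * π * I * n * τ) - cexp (2 * π * I * ((τ + 1) / 2)) ≠ 0 := by
  rw [← norm_pos_iff]
  refine lt_of_lt_of_le ?_ (le_norm_kappaDenominator hτ le_rfl le_rfl n)
  have : rexp (-(π * τ.im)) < 1 := by
    rw [Real.exp_lt_one_iff]
    nlinarith [Real.pi_pos]
  have h2 := Real.exp_pos (-(π * τ.im))
  nlinarith

theorem norm_kappaTerm_le {S T U : ℝ} {x τ : ℂ} (hT : 0 < T) (hx : |x.im| ≤ S) (h1 : T ≤ τ.im)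
    (h2 : τ.im ≤ U) (n : ℤ) :
    ‖cexp (π * I * τ * (n : ℂ) ^ 2 + 2 * π * I * n * x) /
      (cexp (2 * π * I * n * τ) - cexp (2 * π * I * ((τ + 1) / 2)))‖ ≤
    (rexp (-(π * U)) * (1 - rexp (-(π * T))))⁻¹ * rexp (-π * (T * n ^ 2 - 2 * S * |n|)) := by
  have hlt : rexp (-(π * T)) < 1 := by rw [Real.exp_lt_one_iff]; nlinarith [Real.pi_pos]
  have hpos : 0 < rexp (-(π * U)) * (1 - rexp (-(π * T))) :=
    mul_pos (Real.exp_pos _) (by linarith)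
  rw [norm_div, div_eq_inv_mul]
  have h3 := norm_jacobiTheta₂_term_le hT hx h1 n
  rw [jacobiTheta₂_term, show 2 * π * I * n * x + π * I * n ^ 2 * τ =
    π * I * τ * (n : ℂ) ^ 2 + 2 * π * I * n * x by ring] at h3
  exact mul_le_mul (inv_anti₀ hpos (le_norm_kappaDenominator hT h1 h2 n)) h3 (norm_nonneg _)
    (inv_nonneg.2 hpos.le)

theorem summable_kappaBound (S : ℝ) {T : ℝ} (hT : 0 < T) (c : ℝ) :
    Summable fun n : ℤ => c * rexp (-π * (T * n ^ 2 - 2 * S * |n|)) := by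
  simpa using (summable_pow_mul_jacobiTheta₂_term_bound S hT 0).mul_left c

theorem summable_kappaTerm (x : ℂ) {τ : ℂ} (hτ : 0 < τ.im) :
    Summable fun n : ℤ => cexp (π * I * τ * (n : ℂ) ^ 2 + 2 * π * I * n * x) /
      (cexp (2 * π * I * n * τ) - cexp (2 * π * I * ((τ + 1) / 2))) :=
  (summable_kappaBound |x.im| hτ _).of_norm_bounded
    (norm_kappaTerm_le hτ le_rfl le_rfl le_rfl)

/-- Points near `q` have imaginary parts in a compact range. -/
theorem im_bounds_of_mem_ball {q w : ℂ × ℂ} (hw : w ∈ Metric.ball q (q.2.im / 2)) :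
    ‖w.1‖ ≤ ‖q.1‖ + q.2.im / 2 ∧ q.2.im / 2 ≤ w.2.im ∧ w.2.im ≤ q.2.im * 2 := by
  rw [mem_ball_iff_norm] at hw
  have h1 : ‖w.1 - q.1‖ < q.2.im / 2 := (norm_fst_le (w - q)).trans_lt hw
  have h2 : ‖w.2 - q.2‖ < q.2.im / 2 := (norm_snd_le (w - q)).trans_lt hw
  have h3 := Complex.abs_im_le_norm (w.2 - q.2)
  rw [sub_im] at h3
  have h4 := abs_le.1 (h3.trans h2.le)
  have h5 := norm_sub_norm_le w.1 q.1
  refine ⟨by linarith, by linarith, by linarith⟩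

theorem differentiableAt_kappaSeries {q : ℂ × ℂ} (hq : 0 < q.2.im) :
    DifferentiableAt ℂ (fun w : ℂ × ℂ => kappaSeries w.1 w.2) q := by
  have hr : 0 < q.2.im / 2 := by linarith
  refine differentiableAt_tsum_of_norm_le (r := q.2.im / 2)
    (b := fun n => (rexp (-(π * (q.2.im * 2))) * (1 - rexp (-(π * (q.2.im / 2)))))⁻¹ *
      rexp (-π * (q.2.im / 2 * n ^ 2 - 2 * (‖q.1‖ + q.2.im / 2) * |n|))) hr ?_ ?_ ?_
  · intro n w hw
    obtain ⟨-, h2, -⟩ := im_bounds_of_mem_ball hw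
    have h0 := kappaDenominator_ne_zero (hr.trans_le h2) n
    apply DifferentiableAt.differentiableWithinAt
    fun_prop (disch := exact h0)
  · intro n w hw
    obtain ⟨h1, h2, h3⟩ := im_bounds_of_mem_ball hw
    exact norm_kappaTerm_le hr ((Complex.abs_im_le_norm _).trans h1) h2 h3 n
  · exact summable_kappaBound _ hr _

/-! ### The Mordell integral -/

/-- The Mordell integral `h(x, τ) = ∫ exp(πiτw² - 2πxw) / cosh(πw) dw` over the real line. -/
def mordell (x τ : ℂ) : ℂ :=
  ∫ w : ℝ, cexp (π * I * τ * w ^ 2 - 2 * π * x * w) / Complex.cosh (π * w)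

theorem one_le_norm_cosh (w : ℝ) : 1 ≤ ‖Complex.cosh (π * w)‖ := by
  rw [show (π * w : ℂ) = ((π * w : ℝ) : ℂ) by push_cast; rfl, ← Complex.ofReal_cosh,
    Complex.norm_real, Real.norm_eq_abs]
  exact (Real.one_le_cosh _).trans (le_abs_self _)

theorem cosh_pi_mul_ne_zero (w : ℝ) : Complex.cosh (π * w) ≠ 0 := by
  rw [← norm_pos_iff]
  linarith [one_le_norm_cosh w]

/-- One Gaussian dominates for each sign of w; their sum is an integrable bound independent of (x,
τ) in the given range. -/
theorem norm_exp_quadratic_le {S T : ℝ} {x τ : ℂ} (hx : ‖x‖ ≤ S) (hτ : T ≤ τ.im) (w : ℝ) :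
    ‖cexp (π * I * τ * w ^ 2 - 2 * π * x * w)‖ ≤
      rexp (-(π * T) * w ^ 2 + 2 * π * S * w) + rexp (-(π * T) * w ^ 2 + -(2 * π * S) * w) := by
  have hre : (π * I * τ * w ^ 2 - 2 * π * x * w : ℂ).re =
      -(π * τ.im) * w ^ 2 - 2 * π * x.re * w := by
    rw [show (π * I * τ * w ^ 2 - 2 * π * x * w : ℂ) =
      ((π * w ^ 2 : ℝ) : ℂ) * (I * τ) - ((2 * π * w : ℝ) : ℂ) * x by push_cast; ring, sub_re,
      re_ofReal_mul, re_ofReal_mul]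
    simp
    ring
  rw [Complex.norm_exp, hre]
  have h1 := abs_le.1 ((Complex.abs_re_le_norm x).trans hx)
  have hπ := Real.pi_pos
  have h2 : π * T * w ^ 2 ≤ π * τ.im * w ^ 2 := by gcongr
  rcases le_total 0 w with hw | hw
  · have h3 : 0 ≤ (S + x.re) * (π * w) := mul_nonneg (by linarith) (by positivity)
    have : rexp (-(π * τ.im) * w ^ 2 - 2 * π * x.re * w) ≤
        rexp (-(π * T) * w ^ 2 + 2 * π * S * w) :=
      Real.exp_le_exp.2 (by nlinarith)
    linarith [Real.exp_pos (-(π * T) * w ^ 2 + -(2 * π * S) * w)]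
  · have h3 : 0 ≤ (S - x.re) * (π * -w) :=
      mul_nonneg (by linarith) (mul_nonneg hπ.le (by linarith))
    have : rexp (-(π * τ.im) * w ^ 2 - 2 * π * x.re * w) ≤
        rexp (-(π * T) * w ^ 2 + -(2 * π * S) * w) :=
      Real.exp_le_exp.2 (by nlinarith)
    linarith [Real.exp_pos (-(π * T) * w ^ 2 + 2 * π * S * w)]

open MeasureTheory in
theorem integrable_exp_quadratic {b : ℝ} (hb : 0 < b) (c : ℝ) :
    Integrable fun w : ℝ => rexp (-b * w ^ 2 + c * w) := by
  have h := (integrable_cexp_quadratic (b := (b : ℂ)) (by simpa using hb) (c : ℂ) 0).norm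
  refine h.congr (Filter.Eventually.of_forall fun w => ?_)
  simp only [add_zero]
  rw [show (-(b : ℂ) * w ^ 2 + c * w) = ((-b * w ^ 2 + c * w : ℝ) : ℂ) by push_cast; rfl,
    Complex.norm_exp_ofReal]

theorem norm_mordellIntegrand_le {S T : ℝ} {x τ : ℂ} (hx : ‖x‖ ≤ S) (hτ : T ≤ τ.im) (w : ℝ) :
    ‖cexp (π * I * τ * w ^ 2 - 2 * π * x * w) / Complex.cosh (π * w)‖ ≤
      rexp (-(π * T) * w ^ 2 + 2 * π * S * w) + rexp (-(π * T) * w ^ 2 + -(2 * π * S) * w) := by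
  rw [norm_div]
  exact (div_le_self (norm_nonneg _) (one_le_norm_cosh w)).trans (norm_exp_quadratic_le hx hτ w)

theorem continuous_mordellIntegrand (x τ : ℂ) : Continuous fun w : ℝ =>
    cexp (π * I * τ * w ^ 2 - 2 * π * x * w) / Complex.cosh (π * w) := by
  refine Continuous.div (by fun_prop) ?_ cosh_pi_mul_ne_zero
  exact Complex.continuous_cosh.comp (by fun_prop)

open MeasureTheory in
theorem integrable_mordellIntegrand (x : ℂ) {τ : ℂ} (hτ : 0 < τ.im) : Integrable fun w : ℝ =>
    cexp (π * I * τ * w ^ 2 - 2 * π * x * w) / Complex.cosh (π * w) := by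
  have hb : 0 < π * τ.im := mul_pos Real.pi_pos hτ
  exact ((integrable_exp_quadratic hb (2 * π * ‖x‖)).add
    (integrable_exp_quadratic hb (-(2 * π * ‖x‖)))).mono'
    (continuous_mordellIntegrand x τ).aestronglyMeasurable
    (Filter.Eventually.of_forall fun w => norm_mordellIntegrand_le le_rfl le_rfl w)

open MeasureTheory in
theorem differentiableAt_mordell {q : ℂ × ℂ} (hq : 0 < q.2.im) :
    DifferentiableAt ℂ (fun w : ℂ × ℂ => mordell w.1 w.2) q := by
  have hr : 0 < q.2.im / 2 := by linarith
  have hder : ∀ (w : ℝ) (p : ℂ × ℂ), HasFDerivAt (fun p : ℂ × ℂ =>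
      cexp (π * I * p.2 * w ^ 2 - 2 * π * p.1 * w) / Complex.cosh (π * w))
      ((cexp (π * I * p.2 * w ^ 2 - 2 * π * p.1 * w) / Complex.cosh (π * w)) •
        ((π * I * w ^ 2 : ℂ) • ContinuousLinearMap.snd ℂ ℂ ℂ -
          (2 * π * w : ℂ) • ContinuousLinearMap.fst ℂ ℂ ℂ)) p := by
    intro w p
    have h1 : HasFDerivAt (fun p : ℂ × ℂ => (π * I * p.2 * w ^ 2 - 2 * π * p.1 * w : ℂ))
        ((π * I * w ^ 2 : ℂ) • ContinuousLinearMap.snd ℂ ℂ ℂ -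
          (2 * π * w : ℂ) • ContinuousLinearMap.fst ℂ ℂ ℂ) p := by
      have h2 := (((π * I * w ^ 2 : ℂ) • ContinuousLinearMap.snd ℂ ℂ ℂ -
          (2 * π * w : ℂ) • ContinuousLinearMap.fst ℂ ℂ ℂ)).hasFDerivAt (x := p)
      refine h2.congr_of_eventuallyEq (Filter.Eventually.of_forall fun p => ?_)
      simp
      ring
    have h3 := h1.cexp.mul_const (Complex.cosh (π * w))⁻¹
    simp only [← div_eq_mul_inv] at h3
    convert! h3 using 1
    rw [smul_smul, div_eq_inv_mul]
  refine differentiableAt_integral_of_norm_le (r := q.2.im / 2)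
    (b := fun w => rexp (-(π * (q.2.im / 2)) * w ^ 2 + 2 * π * (‖q.1‖ + q.2.im / 2) * w) +
      rexp (-(π * (q.2.im / 2)) * w ^ 2 + -(2 * π * (‖q.1‖ + q.2.im / 2)) * w)) hr
    (fun p _ => (continuous_mordellIntegrand p.1 p.2).aestronglyMeasurable) ?_
    (fun w p _ => (hder w p).differentiableAt.differentiableWithinAt) (fun w => hder w q) ?_ ?_
  · apply Continuous.aestronglyMeasurable
    refine Continuous.smul (continuous_mordellIntegrand q.1 q.2) ?_
    fun_prop
  · intro w p hp
    obtain ⟨h1, h2, -⟩ := im_bounds_of_mem_ball hp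
    exact norm_mordellIntegrand_le h1 h2 w
  · exact (integrable_exp_quadratic (mul_pos Real.pi_pos hr) _).add
      (integrable_exp_quadratic (mul_pos Real.pi_pos hr) _)

/-! ### Translation laws of the Mordell integral -/

section

open MeasureTheory Filter Topology

theorem neg_I_mul_ne_zero {τ : ℂ} (hτ : 0 < τ.im) : -I * τ ≠ 0 := by
  intro h
  have := congrArg Complex.re h
  simp at this
  linarith

/-- Translation by `1` of the Mordell integral. -/
theorem mordell_add_mordell_add_one (x : ℂ) {τ : ℂ} (hτ : 0 < τ.im) :
    mordell x τ + mordell (x + 1) τ =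
      2 / (-I * τ) ^ (1 / 2 : ℂ) * cexp (π * I * (x + 1 / 2) ^ 2 / τ) := by
  have hτ0 : τ ≠ 0 := fun h => by simp [h] at hτ
  have hπ : (π : ℂ) ≠ 0 := by exact_mod_cast Real.pi_ne_zero
  have hre : (π * I * τ : ℂ).re < 0 := by
    have : (π * I * τ : ℂ).re = -(π * τ.im) := by simp
    rw [this]
    nlinarith [Real.pi_pos]
  rw [mordell, mordell, ← integral_add (integrable_mordellIntegrand x hτ)
    (integrable_mordellIntegrand (x + 1) hτ)]
  -- exp(-2πxw) + exp(-2π(x+1)w) = 2 cosh(πw) exp(-2π(x+1/2)w), so the denominator cancels and a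
  -- Gaussian integral is left.
  have h1 : ∀ w : ℝ, cexp (π * I * τ * w ^ 2 - 2 * π * x * w) / Complex.cosh (π * w) +
      cexp (π * I * τ * w ^ 2 - 2 * π * (x + 1) * w) / Complex.cosh (π * w) =
      2 * cexp (π * I * τ * w ^ 2 + (-(2 * π * (x + 1 / 2))) * w + 0) := by
    intro w
    rw [← add_div, div_eq_iff (cosh_pi_mul_ne_zero w), Complex.cosh]
    rw [show (2 * cexp (π * I * τ * w ^ 2 + (-(2 * π * (x + 1 / 2))) * w + 0) *
      ((cexp (π * w) + cexp (-(π * w))) / 2)) =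
      cexp (π * I * τ * w ^ 2 + (-(2 * π * (x + 1 / 2))) * w + 0) * cexp (π * w) +
      cexp (π * I * τ * w ^ 2 + (-(2 * π * (x + 1 / 2))) * w + 0) * cexp (-(π * w)) by ring,
      ← Complex.exp_add, ← Complex.exp_add]
    congr 2 <;> ring
  simp_rw [h1]
  rw [integral_const_mul, integral_cexp_quadratic hre]
  have h2 : (π / -(π * I * τ) : ℂ) = (-I * τ)⁻¹ := by
    field_simp
  -- The principal root commutes with inversion off the negative axis, and Re(-iτ) = Im τ > 0.
  have h3 : (-I * τ).arg ≠ π := by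
    intro h
    have := (Complex.arg_eq_pi_iff.1 h).1
    simp at this
    linarith
  have h4 : (0 - (-(2 * π * (x + 1 / 2))) ^ 2 / (4 * (π * I * τ)) : ℂ) =
      π * I * (x + 1 / 2) ^ 2 / τ := by
    field_simp
    rw [Complex.I_sq]
    ring
  rw [h2, h4, Complex.inv_cpow _ _ h3]
  ring

theorem integrable_inv_cosh : Integrable fun w : ℝ => (Real.cosh (π * w))⁻¹ := by
  refine (integrable_inv_one_add_sq.const_mul 2).mono' ?_ (Eventually.of_forall fun w => ?_)
  · exact ((Real.continuous_cosh.comp (by fun_prop)).inv₀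
      fun w => (Real.cosh_pos _).ne').aestronglyMeasurable
  · rw [Real.norm_eq_abs, abs_of_pos (inv_pos.2 (Real.cosh_pos _))]
    have h1 := Real.quadratic_le_exp_of_nonneg (abs_nonneg (π * w))
    have h2 : rexp |π * w| ≤ 2 * Real.cosh (π * w) := by
      rw [← Real.cosh_abs, Real.cosh_eq]
      linarith [Real.exp_pos (-|π * w|)]
    rw [sq_abs] at h1
    have h3 : 1 + w ^ 2 ≤ 2 * Real.cosh (π * w) := by
      have : 2 * w ^ 2 ≤ (π * w) ^ 2 := by
        rw [mul_pow]
        have : (2 : ℝ) ≤ π ^ 2 := by nlinarith [Real.pi_gt_three]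
        gcongr
      linarith [abs_nonneg (π * w)]
    have h4 : 0 < 1 + w ^ 2 := by positivity
    rw [← div_eq_mul_inv, le_div_iff₀ h4, ← div_eq_inv_mul, div_le_iff₀ (Real.cosh_pos _)]
    exact h3

/-- This normalization takes the place of the residue of 1/cosh(πw) at i/2 in the translation by τ.
-/
theorem integral_inv_cosh : ∫ w : ℝ, (Real.cosh (π * w))⁻¹ = 1 := by
  have hπ := Real.pi_pos
  have hd : ∀ w : ℝ, HasDerivAt (fun w : ℝ => π⁻¹ * Real.arctan (Real.sinh (π * w)))
      (Real.cosh (π * w))⁻¹ w := by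
    intro w
    have h1 : HasDerivAt (fun w : ℝ => π * w) π w := by
      simpa using (hasDerivAt_id w).const_mul π
    have h2 := (h1.sinh.arctan).const_mul π⁻¹
    convert! h2 using 1
    rw [← Real.cosh_sq']
    have := (Real.cosh_pos (π * w)).ne'
    field_simp
  have hlin : Tendsto (fun w : ℝ => π * w) atTop atTop := tendsto_id.const_mul_atTop hπ
  have hlin' : Tendsto (fun w : ℝ => π * w) atBot atBot := tendsto_id.const_mul_atBot hπ
  have htop : Tendsto Real.sinh atTop atTop := Real.sinhOrderIso.tendsto_atTop
  have hbot : Tendsto Real.sinh atBot atBot := Real.sinhOrderIso.tendsto_atBot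
  have h1 : Tendsto (fun w : ℝ => π⁻¹ * Real.arctan (Real.sinh (π * w))) atTop
      (𝓝 (π⁻¹ * (π / 2))) :=
    ((Real.tendsto_arctan_atTop.mono_right nhdsWithin_le_nhds).comp (htop.comp hlin)).const_mul _
  have h2 : Tendsto (fun w : ℝ => π⁻¹ * Real.arctan (Real.sinh (π * w))) atBot
      (𝓝 (π⁻¹ * (-(π / 2)))) :=
    ((Real.tendsto_arctan_atBot.mono_right nhdsWithin_le_nhds).comp (hbot.comp hlin')).const_mul _
  rw [integral_of_hasDerivAt_of_tendsto hd integrable_inv_cosh h2 h1]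
  field_simp
  norm_num

theorem ofReal_inv_cosh (w : ℝ) :
    (((Real.cosh (π * w))⁻¹ : ℝ) : ℂ) = (Complex.cosh (π * w))⁻¹ := by
  push_cast
  rfl

theorem integrable_inv_cosh_complex : Integrable fun w : ℝ => (Complex.cosh (π * w))⁻¹ := by
  exact (integrable_inv_cosh.ofReal (𝕜 := ℂ)).congr (Eventually.of_forall ofReal_inv_cosh)

theorem integral_inv_cosh_complex : ∫ w : ℝ, (Complex.cosh (π * w))⁻¹ = 1 := by
  simp_rw [← ofReal_inv_cosh]
  rw [integral_complex_ofReal, integral_inv_cosh, ofReal_one]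

theorem cosh_pi_mul_I_half : Complex.cosh (π * (I / 2)) = 0 := by
  rw [show (π * (I / 2) : ℂ) = (π / 2 : ℂ) * I by ring, Complex.cosh_mul_I, Complex.cos_pi_div_two]

/-- The zeros of cosh(πw) are i times the half-integers, and only i/2 lies in the strip. -/
theorem cosh_pi_mul_ne_zero_of_strip {w : ℂ} (h0 : 0 ≤ w.im) (h1 : w.im ≤ 1) (hw : w ≠ I / 2) :
    Complex.cosh (π * w) ≠ 0 := by
  intro h
  rw [← Complex.cos_mul_I, Complex.cos_eq_zero_iff] at h
  obtain ⟨k, hk⟩ := h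
  have hπ : (π : ℂ) ≠ 0 := by exact_mod_cast Real.pi_ne_zero
  have e : w = -((2 * k + 1) / 2) * I := by
    have h2 : π * (w * I) = π * ((2 * k + 1) / 2) := by linear_combination hk
    have h3 := mul_left_cancel₀ hπ h2
    linear_combination (-I) * h3 + w * Complex.I_sq
  have him : w.im = -((2 * k + 1) / 2) := by
    rw [e, show (-((2 * k + 1) / 2) * I : ℂ) = ((-((2 * k + 1) / 2) : ℝ) : ℂ) * I by
      push_cast; ring,
      Complex.im_ofReal_mul]
    simp
  rw [him] at h0 h1
  have hk1 : k = -1 := by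
    have a1 : (-2 : ℝ) < k := by linarith
    have a2 : (k : ℝ) < 0 := by linarith
    have b1 : (-2 : ℤ) < k := by exact_mod_cast a1
    have b2 : k < 0 := by exact_mod_cast a2
    omega
  apply hw
  rw [e, hk1]
  push_cast
  ring

/-- Reverse triangle inequality for exp(z) + exp(-z). It controls the vertical sides of the contour.
-/
theorem sinh_le_norm_cosh (z : ℂ) : Real.sinh |z.re| ≤ ‖Complex.cosh z‖ := by
  have h1 := norm_sub_norm_le (cexp z) (-cexp (-z))
  have h2 := norm_sub_norm_le (cexp (-z)) (-cexp z)
  rw [sub_neg_eq_add, norm_neg, Complex.norm_exp, Complex.norm_exp] at h1 h2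
  rw [add_comm (cexp (-z))] at h2
  have h3 : ‖Complex.cosh z‖ = ‖cexp z + cexp (-z)‖ / 2 := by
    rw [Complex.cosh, norm_div, Complex.norm_two]
  rw [h3, Real.sinh_eq]
  simp only [neg_re] at h1 h2
  rcases abs_choice z.re with h | h <;> rw [h]
  · linarith
  · rw [neg_neg]
    linarith

/-- The Gaussian `exp(πiτw² - 2πxw)` shifted by `iy`. -/
theorem exp_quadratic_add_mul_I (x τ a y : ℂ) :
    cexp (π * I * τ * (a + y * I) ^ 2 - 2 * π * x * (a + y * I)) =
      cexp (-(π * I * τ * y ^ 2) - 2 * π * I * x * y) *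
        cexp (π * I * τ * a ^ 2 - 2 * π * (x + τ * y) * a) := by
  rw [← Complex.exp_add]
  congr 1
  linear_combination (π * I * τ * y ^ 2 + 2 * π * τ * a * y) * Complex.I_sq

/-- Shifting by iy replaces x by x + τy, of norm at most S = ‖x‖ + ‖τ‖; completing the square bounds
the resulting Gaussian by exp(πS²/Im τ). -/
theorem exists_norm_exp_quadratic_le (x : ℂ) {τ : ℂ} (hτ : 0 < τ.im) : ∃ C : ℝ, ∀ a y : ℝ,
    0 ≤ y → y ≤ 1 → ‖cexp (π * I * τ * (a + y * I) ^ 2 - 2 * π * x * (a + y * I))‖ ≤ C := by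
  set S := ‖x‖ + ‖τ‖ with hS
  refine ⟨rexp (π * ‖τ‖ + 2 * π * ‖x‖) * (rexp (π * S ^ 2 / τ.im) + rexp (π * S ^ 2 / τ.im)),
    fun a y h0 h1 => ?_⟩
  have hπ := Real.pi_pos
  rw [exp_quadratic_add_mul_I, norm_mul]
  have hsq : ∀ s : ℝ, s ^ 2 = 1 → -(π * τ.im) * a ^ 2 + s * (2 * π * S) * a ≤ π * S ^ 2 / τ.im := by
    intro s hs
    rw [le_div_iff₀ hτ]
    have h2 : 0 ≤ π * (τ.im * a - s * S) ^ 2 := by positivity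
    have h3 : π * S ^ 2 * (s ^ 2 - 1) = 0 := by rw [hs]; ring
    nlinarith
  refine mul_le_mul ?_ ?_ (norm_nonneg _) (Real.exp_pos _).le
  · refine (Complex.norm_exp_le_exp_norm _).trans (Real.exp_le_exp.2 ?_)
    refine (norm_sub_le _ _).trans ?_
    have hy : ‖(y : ℂ)‖ ≤ 1 := by
      rw [Complex.norm_real, Real.norm_eq_abs, abs_of_nonneg h0]
      exact h1
    have hp : ‖(π : ℂ)‖ = π := by rw [Complex.norm_real, Real.norm_eq_abs, abs_of_pos hπ]
    simp only [norm_neg, norm_mul, norm_pow, Complex.norm_I, Complex.norm_two, hp, mul_one]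
    refine add_le_add ?_ ?_
    · exact mul_le_of_le_one_right (by positivity) (pow_le_one₀ (norm_nonneg _) hy)
    · exact mul_le_of_le_one_right (by positivity) hy
  · have hx : ‖x + τ * y‖ ≤ S := by
      refine (norm_add_le _ _).trans ?_
      rw [norm_mul, Complex.norm_real, Real.norm_eq_abs, abs_of_nonneg h0, hS]
      gcongr
      exact mul_le_of_le_one_right (norm_nonneg _) h1
    refine (norm_exp_quadratic_le hx le_rfl a).trans (add_le_add ?_ ?_)
    · exact Real.exp_le_exp.2 (by simpa using hsq 1 (by norm_num))
    · exact Real.exp_le_exp.2 (by simpa using hsq (-1) (by norm_num))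

/-- If `g` is holomorphic on the strip `0 ≤ Im w ≤ 1`, integrable on its boundary lines and
dominated by a multiple of `1 / sinh(π|Re w|)`, then its integrals over the two lines agree. -/
theorem integral_strip_eq {g : ℂ → ℂ} {C : ℝ}
    (hg : DifferentiableOn ℂ g {w | 0 ≤ w.im ∧ w.im ≤ 1})
    (hb : ∀ a y : ℝ, a ≠ 0 → 0 ≤ y → y ≤ 1 → ‖g (a + y * I)‖ ≤ C / Real.sinh (π * |a|))
    (h0 : Integrable fun a : ℝ => g a) (h1 : Integrable fun a : ℝ => g (a + I)) :
    ∫ a : ℝ, g a = ∫ a : ℝ, g (a + I) := by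
  -- Cauchy's theorem on the rectangle [-R, R] × [0, 1]; the vertical sides tend to 0 as R → ∞.
  have hrect : ∀ R : ℝ, 0 < R → (∫ a in (-R)..R, g a) - (∫ a in (-R)..R, g (a + I)) =
      -(I * ∫ y in (0 : ℝ)..1, g ((R : ℝ) + y * I)) +
        I * ∫ y in (0 : ℝ)..1, g ((-R : ℝ) + y * I) := by
    intro R hR
    have := Complex.integral_boundary_rect_eq_zero_of_differentiableOn g (-R : ℝ) ((R : ℝ) + I)
      (hg.mono fun w hw => ?_)
    · simp only [ofReal_re, ofReal_im, add_re, add_im, Complex.I_re, Complex.I_im, add_zero,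
        zero_add, ofReal_zero, zero_mul, ofReal_one, one_mul, smul_eq_mul] at this
      linear_combination this
    · have := hw.2
      simp only [ofReal_im, add_im, Complex.I_im, zero_add, Set.mem_preimage,
        Set.uIcc_of_le zero_le_one] at this
      exact this
  have hvert : ∀ s : ℝ, s ^ 2 = 1 →
      Tendsto (fun R : ℝ => ∫ y in (0 : ℝ)..1, g ((s * R : ℝ) + y * I)) atTop (𝓝 0) := by
    intro s hs
    have hs0 : s ≠ 0 := fun h => by simp [h] at hs
    have habs : |s| = 1 := by
      rw [← sq_eq_sq₀ (abs_nonneg s) zero_le_one, sq_abs, hs, one_pow]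
    have hlim : Tendsto (fun R : ℝ => C / Real.sinh (π * R)) atTop (𝓝 0) := by
      have htop : Tendsto Real.sinh atTop atTop := Real.sinhOrderIso.tendsto_atTop
      exact (htop.comp (tendsto_id.const_mul_atTop Real.pi_pos)).const_div_atTop C
    refine squeeze_zero_norm' ?_ hlim
    filter_upwards [eventually_gt_atTop 0] with R hR
    have := intervalIntegral.norm_integral_le_of_norm_le_const (a := 0) (b := 1)
      (f := fun y : ℝ => g ((s * R : ℝ) + y * I)) (C := C / Real.sinh (π * R)) ?_
    · simpa using this
    · intro y hy
      rw [Set.uIoc_of_le zero_le_one] at hy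
      have := hb (s * R) y (mul_ne_zero hs0 hR.ne') hy.1.le hy.2
      rwa [abs_mul, habs, one_mul, abs_of_pos hR] at this
  have l0 := intervalIntegral_tendsto_integral h0 tendsto_neg_atTop_atBot tendsto_id
  have l1 := intervalIntegral_tendsto_integral h1 tendsto_neg_atTop_atBot tendsto_id
  have v1 := hvert 1 (by norm_num)
  have v2 := hvert (-1) (by norm_num)
  simp only [one_mul, neg_mul] at v1 v2
  have lim : Tendsto (fun R : ℝ => (∫ a in (-R)..R, g a) - (∫ a in (-R)..R, g (a + I))) atTop
      (𝓝 0) := by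
    have := (v1.const_mul I).neg.add (v2.const_mul I)
    simp only [mul_zero, neg_zero, add_zero] at this
    refine this.congr' ?_
    filter_upwards [eventually_gt_atTop 0] with R hR
    rw [hrect R hR]
  exact sub_eq_zero.1 (tendsto_nhds_unique (l0.sub l1) lim)

/-- Translation by `τ` of the Mordell integral. -/
theorem mordell_add_mordell_add_tau (x : ℂ) {τ : ℂ} (hτ : 0 < τ.im) :
    mordell x τ + cexp (-(π * I * τ) - 2 * π * I * x) * mordell (x + τ) τ =
      2 * cexp (-(π * I * τ) / 4 - π * I * x) := by
  set E : ℂ → ℂ := fun w => cexp (π * I * τ * w ^ 2 - 2 * π * x * w) with hE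
  set c : ℂ → ℂ := fun w => Complex.cosh (π * w) with hc
  set q : ℂ := I / 2 with hq
  have hcq : c q = 0 := cosh_pi_mul_I_half
  have hEd : Differentiable ℂ E := by intro w; simp only [hE]; fun_prop
  have hcd' : ∀ w, HasDerivAt c (Complex.sinh (π * w) * π) w := fun w => by
    have : HasDerivAt (fun w : ℂ => (π : ℂ) * w) π w := by
      simpa using (hasDerivAt_id w).const_mul (π : ℂ)
    exact this.ccosh
  have hcd : Differentiable ℂ c := fun w => (hcd' w).differentiableAt
  have hEs : Differentiable ℂ (dslope E q) := by
    rw [← differentiableOn_univ, Complex.differentiableOn_dslope univ_mem]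
    exact hEd.differentiableOn
  have hcs : Differentiable ℂ (dslope c q) := by
    rw [← differentiableOn_univ, Complex.differentiableOn_dslope univ_mem]
    exact hcd.differentiableOn
  -- The integrand E/c has a simple pole at q = i/2. Subtracting E(q)/c removes it: g is the
  -- holomorphic extension of (E - E(q))/c. As c changes sign between the two lines, the subtracted
  -- terms contribute E(q) twice, which is the right-hand side.
  set g : ℂ → ℂ := fun w => dslope E q w / dslope c q w with hgdef
  have hgne : ∀ w, w ≠ q → g w = (E w - E q) * (c w)⁻¹ := by
    intro w hw
    simp only [hgdef]
    rw [dslope_of_ne _ hw, dslope_of_ne _ hw, slope_def_field, slope_def_field, hcq, sub_zero,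
      div_div_div_cancel_right₀ (sub_ne_zero.2 hw), div_eq_mul_inv]
  have hne0 : ∀ a : ℝ, (a : ℂ) ≠ q := fun a h => by
    have := congrArg Complex.im h
    simp [hq] at this
  have hne1 : ∀ a : ℝ, (a : ℂ) + I ≠ q := fun a h => by
    have := congrArg Complex.im h
    simp [hq] at this
  have hshift : ∀ a : ℝ, E (a + I) = cexp (-(π * I * τ) - 2 * π * I * x) *
      cexp (π * I * τ * a ^ 2 - 2 * π * (x + τ) * a) := fun a => by
    have := exp_quadratic_add_mul_I x τ a 1
    simp only [one_mul, one_pow, mul_one] at this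
    exact this
  have hcshift : ∀ a : ℝ, c (a + I) = -Complex.cosh (π * a) := fun a => by
    simp only [hc]
    rw [mul_add, Complex.cosh_add, mul_comm (π : ℂ) I, mul_comm I (π : ℂ), Complex.cosh_mul_I,
      Complex.sinh_mul_I]
    simp
  have hg0 : ∀ a : ℝ, g a = cexp (π * I * τ * a ^ 2 - 2 * π * x * a) / Complex.cosh (π * a) -
      E q * (Complex.cosh (π * a))⁻¹ := fun a => by
    rw [hgne _ (hne0 a)]
    simp only [hE, hc]
    ring
  have hg1 : ∀ a : ℝ, g (a + I) = E q * (Complex.cosh (π * a))⁻¹ -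
      cexp (-(π * I * τ) - 2 * π * I * x) *
        (cexp (π * I * τ * a ^ 2 - 2 * π * (x + τ) * a) / Complex.cosh (π * a)) := fun a => by
    rw [hgne _ (hne1 a), hshift, hcshift, inv_neg]
    ring
  have i0 := (integrable_mordellIntegrand x hτ).sub (integrable_inv_cosh_complex.const_mul (E q))
  have i1 := (integrable_inv_cosh_complex.const_mul (E q)).sub
    ((integrable_mordellIntegrand (x + τ) hτ).const_mul (cexp (-(π * I * τ) - 2 * π * I * x)))
  obtain ⟨C, hC⟩ := exists_norm_exp_quadratic_le x hτ
  have hEq : ‖E q‖ ≤ C := by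
    have := hC 0 (1 / 2) (by norm_num) (by norm_num)
    rwa [show (((0 : ℝ) : ℂ) + ((1 / 2 : ℝ) : ℂ) * I) = q by push_cast; rw [hq]; ring] at this
  have key := integral_strip_eq (g := g) (C := 2 * C) ?_ ?_ ?_ ?_
  · simp_rw [hg0, hg1] at key
    rw [integral_sub (integrable_mordellIntegrand x hτ)
      (integrable_inv_cosh_complex.const_mul (E q)),
      integral_sub (integrable_inv_cosh_complex.const_mul (E q))
      ((integrable_mordellIntegrand (x + τ) hτ).const_mul _), integral_const_mul,
      integral_const_mul, integral_inv_cosh_complex] at key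
    have hEval : E q = cexp (-(π * I * τ) / 4 - π * I * x) := by
      simp only [hE, hq]
      congr 1
      linear_combination (π * I * τ / 4) * Complex.I_sq
    rw [← hEval, mordell, mordell]
    linear_combination key
  · intro w hw
    apply DifferentiableAt.differentiableWithinAt
    refine DifferentiableAt.fun_div (hEs w) (hcs w) ?_
    by_cases hwq : w = q
    -- At q the denominator is c'(q) = π sinh(πi/2) = πi.
    · rw [hwq, dslope_same, (hcd' q).deriv, hq,
        show (π * (I / 2) : ℂ) = (π / 2 : ℂ) * I by ring, Complex.sinh_mul_I,
        Complex.sin_pi_div_two]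
      have : (π : ℂ) ≠ 0 := by exact_mod_cast Real.pi_ne_zero
      simp [this]
    · rw [dslope_of_ne _ hwq, slope_def_field, hcq, sub_zero]
      exact div_ne_zero (cosh_pi_mul_ne_zero_of_strip hw.1 hw.2 hwq) (sub_ne_zero.2 hwq)
  · intro a y ha hy0 hy1
    have hsinh : 0 < Real.sinh (π * |a|) :=
      Real.sinh_pos_iff.2 (mul_pos Real.pi_pos (abs_pos.2 ha))
    have hre : ((a : ℂ) + y * I) ≠ q := fun h => ha (by
      have := congrArg Complex.re h
      simpa [hq] using this)
    have h2 := sinh_le_norm_cosh (π * ((a : ℂ) + y * I))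
    rw [show (π * ((a : ℂ) + y * I)).re = π * a by simp, abs_mul, abs_of_pos Real.pi_pos] at h2
    rw [hgne _ hre, ← div_eq_mul_inv, norm_div]
    refine div_le_div₀ ?_ ?_ hsinh h2
    · linarith [norm_nonneg (E q)]
    · linarith [norm_sub_le (E ((a : ℂ) + y * I)) (E q), hC a y hy0 hy1]
  · exact i0.congr (Eventually.of_forall fun a => (hg0 a).symm)
  · exact i1.congr (Eventually.of_forall fun a => (hg1 a).symm)

end

/-! ### Functional equations of Appell's function -/

theorem exp_two_pi_I_mul_int (n : ℤ) : cexp (2 * π * I * n) = 1 := by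
  rw [Complex.exp_eq_one_iff]
  exact ⟨n, by ring⟩

theorem kappaSeries_add_one (x τ : ℂ) : kappaSeries (x + 1) τ = kappaSeries x τ := by
  refine tsum_congr fun n => ?_
  rw [show π * I * τ * (n : ℂ) ^ 2 + 2 * π * I * n * (x + 1) =
    π * I * τ * (n : ℂ) ^ 2 + 2 * π * I * n * x + 2 * π * I * n by ring, Complex.exp_add,
    exp_two_pi_I_mul_int, mul_one]

theorem kappaSeries_add_two (x τ : ℂ) : kappaSeries x (τ + 2) = kappaSeries x τ := by
  refine tsum_congr fun n => ?_
  have h1 : cexp (2 * π * I * ((τ + 2 + 1) / 2)) = cexp (2 * π * I * ((τ + 1) / 2)) := by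
    rw [show 2 * π * I * ((τ + 2 + 1) / 2) = 2 * π * I * ((τ + 1) / 2) + 2 * π * I * (1 : ℤ) by
      push_cast; ring, Complex.exp_add, exp_two_pi_I_mul_int, mul_one]
  have h2 : cexp (2 * π * I * n * (τ + 2)) = cexp (2 * π * I * n * τ) := by
    rw [show 2 * π * I * n * (τ + 2) = 2 * π * I * n * τ + 2 * π * I * ((2 * n : ℤ) : ℂ) by
      push_cast; ring, Complex.exp_add, exp_two_pi_I_mul_int, mul_one]
  have h3 : cexp (π * I * (τ + 2) * (n : ℂ) ^ 2 + 2 * π * I * n * x) =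
      cexp (π * I * τ * (n : ℂ) ^ 2 + 2 * π * I * n * x) := by
    rw [show π * I * (τ + 2) * (n : ℂ) ^ 2 + 2 * π * I * n * x = π * I * τ * (n : ℂ) ^ 2 +
      2 * π * I * n * x + 2 * π * I * ((n ^ 2 : ℤ) : ℂ) by push_cast; ring, Complex.exp_add,
      exp_two_pi_I_mul_int, mul_one]
  rw [h1, h2, h3]

/-- Termwise, exp(2πinτ) = (exp(2πinτ) - exp(2πiy)) + exp(2πiy) with y = (τ+1)/2: the bracket
cancels the denominator and leaves the theta series. -/
theorem kappaSeries_add_tau (x : ℂ) {τ : ℂ} (hτ : 0 < τ.im) :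
    kappaSeries (x + τ) τ = cexp (π * I * (τ + 1)) * kappaSeries x τ + jacobiTheta₂ x τ := by
  rw [kappaSeries, kappaSeries, jacobiTheta₂, ← tsum_mul_left,
    ← Summable.tsum_add ((summable_kappaTerm x hτ).mul_left _)
      ((summable_jacobiTheta₂_term_iff x τ).2 hτ)]
  refine tsum_congr fun n => ?_
  have h0 := kappaDenominator_ne_zero hτ n
  rw [show π * I * (τ + 1) = 2 * π * I * ((τ + 1) / 2) by ring, jacobiTheta₂_term,
    show 2 * π * I * n * x + π * I * n ^ 2 * τ =
      π * I * τ * (n : ℂ) ^ 2 + 2 * π * I * n * x by ring,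
    show π * I * τ * (n : ℂ) ^ 2 + 2 * π * I * n * (x + τ) =
      π * I * τ * (n : ℂ) ^ 2 + 2 * π * I * n * x + 2 * π * I * n * τ by ring, Complex.exp_add _
      (2 * π * I * n * τ)]
  rw [div_eq_iff h0, add_mul, mul_div_assoc', div_mul_cancel₀ _ h0]
  ring

/-- Appell's function normalized so that it changes sign under `x ↦ x + 1`. -/
def appellM (x τ : ℂ) : ℂ := cexp (3 * π * I * τ / 4 - π * I * x) * kappaSeries x τ

theorem appellM_add_one (x τ : ℂ) : appellM (x + 1) τ = -appellM x τ := by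
  rw [appellM, appellM, kappaSeries_add_one,
    show 3 * π * I * τ / 4 - π * I * (x + 1) = 3 * π * I * τ / 4 - π * I * x - π * I by ring,
    Complex.exp_sub _ (π * I), Complex.exp_pi_mul_I]
  ring

theorem appellM_add_tau (x : ℂ) {τ : ℂ} (hτ : 0 < τ.im) :
    appellM (x + τ) τ =
      -appellM x τ + cexp (-(π * I * τ) / 4 - π * I * x) * jacobiTheta₂ x τ := by
  rw [appellM, appellM, kappaSeries_add_tau x hτ, mul_add, ← mul_assoc, ← Complex.exp_add,
    show 3 * π * I * τ / 4 - π * I * (x + τ) + π * I * (τ + 1) =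
      3 * π * I * τ / 4 - π * I * x + π * I by ring,
    show 3 * π * I * τ / 4 - π * I * (x + τ) = -(π * I * τ) / 4 - π * I * x by ring,
    Complex.exp_add, Complex.exp_pi_mul_I]
  ring

/-! ### The inversion law for Appell's function -/

theorem jacobiTheta₂_inversion (x : ℂ) {τ : ℂ} (hτ : 0 < τ.im) :
    jacobiTheta₂ (x / τ) (-1 / τ) =
      (-I * τ) ^ (1 / 2 : ℂ) * cexp (π * I * x ^ 2 / τ) * jacobiTheta₂ x τ := by
  have h0 : (-I * τ) ^ (1 / 2 : ℂ) ≠ 0 := by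
    rw [Ne, Complex.cpow_eq_zero_iff]
    exact fun h => neg_I_mul_ne_zero hτ h.1
  have h1 : cexp (π * I * x ^ 2 / τ) * cexp (-π * I * x ^ 2 / τ) = 1 := by
    rw [← Complex.exp_add, ← Complex.exp_zero]
    congr 1
    ring
  rw [jacobiTheta₂_functional_equation x τ, one_div ((-I * τ) ^ (1 / 2 : ℂ))]
  have h2 := mul_inv_cancel₀ h0
  linear_combination (-jacobiTheta₂ (x / τ) (-1 / τ)) * h1 -
    jacobiTheta₂ (x / τ) (-1 / τ) * cexp (π * I * x ^ 2 / τ) * cexp (-π * I * x ^ 2 / τ) * h2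

/-- An entire function that changes sign under two independent translations vanishes. -/
theorem eq_zero_of_antiperiodic {f : ℂ → ℂ} {τ : ℂ} (hτ : 0 < τ.im) (hf : Differentiable ℂ f)
    (h1 : ∀ x, f (x + 1) = -f x) (h2 : ∀ x, f (x + τ) = -f x) (x : ℂ) : f x = 0 := by
  -- |f| is doubly periodic, hence bounded by its maximum on a fundamental parallelogram; Liouville
  -- makes f constant, and a sign change makes it zero.
  have p1 : Function.Periodic (fun x => ‖f x‖) (1 : ℂ) := fun x => by simp [h1]
  have p2 : Function.Periodic (fun x => ‖f x‖) τ := fun x => by simp [h2]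
  have hK : IsCompact ((fun v : ℝ × ℝ => (v.1 : ℂ) + v.2 * τ) ''
      (Set.Icc (0 : ℝ) 1 ×ˢ Set.Icc (0 : ℝ) 1)) :=
    (isCompact_Icc.prod isCompact_Icc).image (by fun_prop)
  obtain ⟨C, hC⟩ := hK.exists_bound_of_continuousOn hf.continuous.continuousOn
  have hbound : ∀ x, ‖f x‖ ≤ C := by
    intro x
    set s : ℝ := x.im / τ.im with hs
    set r : ℝ := x.re - s * τ.re with hr
    have hx : x = (r : ℂ) + s * τ := by
      apply Complex.ext
      · simp [hr]
      · simp [hs, div_mul_cancel₀ _ hτ.ne']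
    have e1 := p1.sub_int_mul_eq (x := x - (⌊s⌋ : ℂ) * τ) ⌊r⌋
    have e2 := p2.sub_int_mul_eq (x := x) ⌊s⌋
    simp only [mul_one] at e1
    rw [← e2, ← e1]
    apply hC
    refine ⟨(Int.fract r, Int.fract s), ⟨⟨Int.fract_nonneg _, (Int.fract_lt_one _).le⟩,
      ⟨Int.fract_nonneg _, (Int.fract_lt_one _).le⟩⟩, ?_⟩
    simp only [Int.fract]
    rw [hx]
    push_cast
    ring
  have hconst := hf.apply_eq_apply_of_bounded
    (isBounded_iff_forall_norm_le.2 ⟨C, by rintro _ ⟨x, rfl⟩; exact hbound x⟩) (x + 1) x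
  rw [h1] at hconst
  have : 2 * f x = 0 := by linear_combination -hconst
  simpa using this

theorem neg_one_div_im_pos {τ : ℂ} (hτ : 0 < τ.im) : 0 < (-1 / τ).im := by
  have hτ0 : τ ≠ 0 := fun h => by simp [h] at hτ
  rw [neg_div, one_div, neg_im, Complex.inv_im, neg_div, neg_neg]
  exact div_pos hτ (Complex.normSq_pos.2 hτ0)

theorem differentiable_kappaSeries_left {τ : ℂ} (hτ : 0 < τ.im) :
    Differentiable ℂ fun x => kappaSeries x τ := fun x =>
  (differentiableAt_kappaSeries (q := (x, τ)) hτ).comp x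
    (f := fun x : ℂ => (x, τ)) (by fun_prop)

theorem differentiable_mordell_left {τ : ℂ} (hτ : 0 < τ.im) :
    Differentiable ℂ fun x => mordell x τ := fun x =>
  (differentiableAt_mordell (q := (x, τ)) hτ).comp x (f := fun x : ℂ => (x, τ)) (by fun_prop)

theorem differentiable_appellM_left {τ : ℂ} (hτ : 0 < τ.im) :
    Differentiable ℂ fun x => appellM x τ := by
  have := differentiable_kappaSeries_left hτ
  unfold appellM
  fun_prop

/-- The behaviour of Appell's function under the inversion `τ ↦ -1/τ`. -/
theorem appellM_inversion (x : ℂ) {τ : ℂ} (hτ : 0 < τ.im) :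
    appellM (x / τ) (-1 / τ) =
      I * τ * appellM x τ - I * τ / 2 * mordell x τ * jacobiTheta₂ x τ := by
  have hτ0 : τ ≠ 0 := fun h => by simp [h] at hτ
  have hτ' := neg_one_div_im_pos hτ
  set r : ℂ := (-I * τ) ^ (1 / 2 : ℂ) with hr
  have hr0 : r ≠ 0 := by
    rw [hr, Ne, Complex.cpow_eq_zero_iff]
    exact fun h => neg_I_mul_ne_zero hτ h.1
  have hrr : r * r = -I * τ := by
    rw [hr, ← Complex.cpow_add _ _ (neg_I_mul_ne_zero hτ)]
    norm_num
  set f : ℂ → ℂ := fun x => appellM (x / τ) (-1 / τ) - I * τ * appellM x τ +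
    I * τ / 2 * mordell x τ * jacobiTheta₂ x τ with hf
  suffices h : f x = 0 by
    simp only [hf] at h
    linear_combination h
  refine eq_zero_of_antiperiodic hτ ?_ ?_ ?_ x
  · have d1 := differentiable_appellM_left hτ
    have d2 : Differentiable ℂ fun x : ℂ => appellM (x / τ) (-1 / τ) :=
      (differentiable_appellM_left hτ').comp (differentiable_id.div_const τ)
    have d3 := differentiable_mordell_left hτ
    have d4 : Differentiable ℂ fun x => jacobiTheta₂ x τ :=
      fun x => differentiableAt_jacobiTheta₂_fst x hτ
    exact (d2.sub (d1.const_mul _)).add ((d3.const_mul _).mul d4)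
  · intro x
    -- For the modulus -1/τ, going from (x+1)/τ to x/τ is a translation by the modulus, so x ↦ x+1
    -- uses the τ-law on the left side; conversely x ↦ x+τ uses its law for translation by 1.
    have e1 := appellM_add_tau ((x + 1) / τ) hτ'
    rw [show (x + 1) / τ + -1 / τ = x / τ by ring, jacobiTheta₂_inversion _ hτ,
      jacobiTheta₂_add_left] at e1
    have e2 := appellM_add_one x τ
    have e3 := mordell_add_mordell_add_one x hτ
    have e4 : cexp (-(π * I * (-1 / τ)) / 4 - π * I * ((x + 1) / τ)) *
        cexp (π * I * (x + 1) ^ 2 / τ) = cexp (π * I * (x + 1 / 2) ^ 2 / τ) := by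
      rw [← Complex.exp_add]
      congr 1
      ring
    rw [← hr] at e1 e3
    have e5 : r * (mordell x τ + mordell (x + 1) τ) = 2 * cexp (π * I * (x + 1 / 2) ^ 2 / τ) := by
      rw [e3]
      field_simp
    simp only [hf, jacobiTheta₂_add_left]
    linear_combination e1 - I * τ * e2 + r * jacobiTheta₂ x τ * e4 -
      r / 2 * jacobiTheta₂ x τ * e5 +
      (mordell x τ + mordell (x + 1) τ) * jacobiTheta₂ x τ / 2 * hrr
  · intro x
    have e1 := appellM_add_one (x / τ) (-1 / τ)
    have e2 := appellM_add_tau x hτ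
    have e3 := mordell_add_mordell_add_tau x hτ
    have e4 := jacobiTheta₂_add_left' x τ
    rw [show -π * I * (τ + 2 * x) = -(π * I * τ) - 2 * π * I * x by ring] at e4
    simp only [hf]
    rw [show (x + τ) / τ = x / τ + 1 by field_simp, e4]
    linear_combination e1 - I * τ * e2 + I * τ / 2 * jacobiTheta₂ x τ * e3

/-- For fixed `τ` the theta function is not identically zero. -/
theorem exists_jacobiTheta₂_ne_zero {τ : ℂ} (hτ : 0 < τ.im) : ∃ x, jacobiTheta₂ x τ ≠ 0 := by
  by_contra! h
  -- The zeroth Fourier coefficient of θ(·,τ) is 1, so it would be both 0 and 1.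
  have hsum := intervalIntegral.hasSum_intervalIntegral_of_summable_norm (a := 0) (b := 1)
    (f := fun n : ℤ => (⟨fun x : ℝ => jacobiTheta₂_term n x τ, by
      unfold jacobiTheta₂_term; fun_prop⟩ : C(ℝ, ℂ))) ?_
  · have h0 : ∀ x : ℝ, ∑' n : ℤ, jacobiTheta₂_term n x τ = 0 := fun x => h x
    simp only [ContinuousMap.coe_mk, h0, intervalIntegral.integral_zero] at hsum
    have hterm : ∀ n : ℤ, (∫ x in (0 : ℝ)..1, jacobiTheta₂_term n x τ) =
        if n = 0 then 1 else 0 := by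
      intro n
      split_ifs with hn
      · simp [hn, jacobiTheta₂_term]
      · have hc : (2 * π * I * n : ℂ) ≠ 0 := by
          have : (π : ℂ) ≠ 0 := by exact_mod_cast Real.pi_ne_zero
          have hn' : (n : ℂ) ≠ 0 := by exact_mod_cast hn
          simp [this, hn', Complex.I_ne_zero]
        simp only [jacobiTheta₂_term, Complex.exp_add]
        rw [intervalIntegral.integral_mul_const, integral_exp_mul_complex hc]
        simp [exp_two_pi_I_mul_int]
    simp only [hterm] at hsum
    have := hsum.unique (hasSum_ite_eq 0 (1 : ℂ))
    exact zero_ne_one this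
  · refine (summable_kappaBound 0 hτ 1).of_nonneg_of_le (fun n => norm_nonneg _) fun n => ?_
    rw [one_mul]
    refine (ContinuousMap.norm_le _ (Real.exp_pos _).le).2 fun x => ?_
    exact norm_jacobiTheta₂_term_le hτ (by simp) le_rfl n

/-! ### Holomorphic functions on `ℂ × ℍ` -/

theorem isOpen_im_pos : IsOpen {w : ℂ × ℂ | 0 < w.2.im} :=
  isOpen_lt continuous_const (Complex.continuous_im.comp continuous_snd)

theorem coe_ofComplex_of_im_pos {w : ℂ} (hw : 0 < w.im) : ((ofComplex w : ℍ) : ℂ) = w := by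
  rw [UpperHalfPlane.ofComplex_apply_of_im_pos hw]

/-- A function on `ℂ × ℍ` is holomorphic if it is given by a differentiable expression. -/
theorem isHolo_of_eq {f : ℂ × ℍ → ℂ} (F : ℂ × ℂ → ℂ) (h : ∀ x (τ : ℍ), f (x, τ) = F (x, τ))
    (hF : ∀ q : ℂ × ℂ, 0 < q.2.im → DifferentiableAt ℂ F q) : IsHolo f := by
  have h1 : DifferentiableOn ℂ F {w : ℂ × ℂ | 0 < w.2.im} :=
    fun q hq => (hF q hq).differentiableWithinAt
  refine h1.congr fun w hw => ?_
  rw [h, coe_ofComplex_of_im_pos hw]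

theorem IsHolo.differentiableAt {f : ℂ × ℍ → ℂ} (hf : IsHolo f) {q : ℂ × ℂ} (hq : 0 < q.2.im) :
    DifferentiableAt ℂ (fun w : ℂ × ℂ => f (w.1, ofComplex w.2)) q :=
  DifferentiableOn.differentiableAt hf (isOpen_im_pos.mem_nhds hq)

theorem isHolo_const (c : ℂ) : IsHolo fun _ => c := differentiableOn_const c

theorem isHolo_fst : IsHolo fun p => p.1 :=
  isHolo_of_eq (fun w => w.1) (fun _ _ => rfl) fun _ _ => by fun_prop

theorem isHolo_snd : IsHolo fun p => (p.2 : ℂ) :=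
  isHolo_of_eq (fun w => w.2) (fun _ _ => rfl) fun _ _ => by fun_prop

theorem IsHolo.mul {f g : ℂ × ℍ → ℂ} (hf : IsHolo f) (hg : IsHolo g) :
    IsHolo fun p => f p * g p :=
  DifferentiableOn.mul hf hg

theorem IsHolo.add {f g : ℂ × ℍ → ℂ} (hf : IsHolo f) (hg : IsHolo g) :
    IsHolo fun p => f p + g p :=
  DifferentiableOn.add hf hg

theorem IsHolo.sub {f g : ℂ × ℍ → ℂ} (hf : IsHolo f) (hg : IsHolo g) :
    IsHolo fun p => f p - g p :=
  DifferentiableOn.sub hf hg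

theorem IsHolo.neg {f : ℂ × ℍ → ℂ} (hf : IsHolo f) : IsHolo fun p => -f p :=
  DifferentiableOn.neg hf

theorem IsHolo.inv {f : ℂ × ℍ → ℂ} (hf : IsHolo f) (h0 : ∀ p, f p ≠ 0) :
    IsHolo fun p => (f p)⁻¹ :=
  DifferentiableOn.inv hf fun _ _ => h0 _

theorem IsHolo.div {f g : ℂ × ℍ → ℂ} (hf : IsHolo f) (hg : IsHolo g) (h0 : ∀ p, g p ≠ 0) :
    IsHolo fun p => f p / g p := by
  simpa only [div_eq_mul_inv] using hf.mul (hg.inv h0)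

theorem IsHolo.cexp {f : ℂ × ℍ → ℂ} (hf : IsHolo f) : IsHolo fun p => cexp (f p) :=
  DifferentiableOn.cexp hf

theorem IsHolo.continuous {f : ℂ × ℍ → ℂ} (hf : IsHolo f) : Continuous f := by
  rw [continuous_iff_continuousAt]
  intro p
  have h1 := (hf.differentiableAt (q := (p.1, (p.2 : ℂ))) p.2.im_pos).continuousAt
  have h2 : Continuous fun p : ℂ × ℍ => (p.1, (p.2 : ℂ)) := by fun_prop
  have h3 := ContinuousAt.comp (f := fun p : ℂ × ℍ => (p.1, (p.2 : ℂ))) (x := p) h1 h2.continuousAt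
  refine h3.congr (Filter.Eventually.of_forall fun p => ?_)
  simp [UpperHalfPlane.ofComplex_apply]

theorem isHolo_autFactor (γ : Gamma12) : IsHolo fun p => autFactor γ p.2 :=
  isHolo_of_eq (fun w => (ec γ : ℂ) * w.2 + (ed γ : ℂ)) (fun _ _ => rfl) fun _ _ => by fun_prop

theorem isHolo_smul (γ : Gamma12) : IsHolo fun p => (((γ : SL(2, ℤ)) • p.2 : ℍ) : ℂ) := by
  simp only [coe_smul_eq]
  exact (((isHolo_const _).mul isHolo_snd).add (isHolo_const _)).div (isHolo_autFactor γ)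
    fun p => autFactor_ne_zero γ p.2

/-- Composition with the action of the group preserves holomorphic functions. -/
theorem IsHolo.comp_smul {f : ℂ × ℍ → ℂ} (hf : IsHolo f) (g : UnivGroup) :
    IsHolo fun p => f (g • p) := by
  have h2 := isHolo_smul g.right
  have h1 : IsHolo fun p => (g • p).1 := ((isHolo_fst.div (isHolo_autFactor g.right)
    fun p => autFactor_ne_zero _ p.2).add (isHolo_const _)).add ((isHolo_const _).mul h2)
  intro w hw
  apply DifferentiableAt.differentiableWithinAt
  have h3 := (h1.differentiableAt hw).prodMk (h2.differentiableAt hw)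
  have h4 := hf.differentiableAt (q := ((g • ((w.1, ofComplex w.2) : ℂ × ℍ)).1,
    (((g.right : SL(2, ℤ)) • ofComplex w.2 : ℍ) : ℂ))) (UpperHalfPlane.im_pos _)
  have h5 := DifferentiableAt.comp (f := fun w : ℂ × ℂ => ((g • ((w.1, ofComplex w.2) : ℂ × ℍ)).1,
    (((g.right : SL(2, ℤ)) • ofComplex w.2 : ℍ) : ℂ))) w h4 h3
  refine h5.congr_of_eventuallyEq (Filter.Eventually.of_forall fun w => ?_)
  simp only [Function.comp_apply, UpperHalfPlane.ofComplex_apply]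
  rfl

theorem isHolo_theta : IsHolo theta :=
  isHolo_of_eq (fun w => jacobiTheta₂ w.1 w.2) (fun _ _ => rfl) fun q hq =>
    (hasFDerivAt_jacobiTheta₂ q.1 hq).differentiableAt

theorem isHolo_kappaHalf : IsHolo kappaHalf :=
  isHolo_of_eq (fun w => kappaSeries w.1 w.2) (fun _ _ => rfl) fun _ hq =>
    differentiableAt_kappaSeries hq

/-- Continuous functions that agree after multiplication by `θ` are equal. -/
theorem eq_of_mul_theta_eq {f g : ℂ × ℍ → ℂ} (hf : Continuous f) (hg : Continuous g)
    (h : ∀ p, f p * theta p = g p * theta p) (p : ℂ × ℍ) : f p = g p := by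
  obtain ⟨x, τ⟩ := p
  have han : AnalyticOnNhd ℂ (fun x => jacobiTheta₂ x τ) Set.univ :=
    DifferentiableOn.analyticOnNhd
      (fun x _ => (differentiableAt_jacobiTheta₂_fst x τ.im_pos).differentiableWithinAt) isOpen_univ
  -- Zeros of θ(·,τ) are isolated, so f and g agree on a punctured neighbourhood of x, and by
  -- continuity at x.
  have hne : ∀ᶠ z in nhdsWithin x {x}ᶜ, jacobiTheta₂ z τ ≠ 0 := by
    rcases (han x (Set.mem_univ x)).eventually_eq_zero_or_eventually_ne_zero with h0 | h0
    · obtain ⟨y, hy⟩ := exists_jacobiTheta₂_ne_zero τ.im_pos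
      exact absurd (han.eqOn_zero_of_preconnected_of_eventuallyEq_zero isPreconnected_univ
        (Set.mem_univ x) h0 (Set.mem_univ y)) hy
    · exact h0
  have hf' : Filter.Tendsto (fun z => f (z, τ)) (nhdsWithin x {x}ᶜ) (nhds (f (x, τ))) :=
    ((hf.comp (Continuous.prodMk_left τ)).tendsto x).mono_left nhdsWithin_le_nhds
  have hg' : Filter.Tendsto (fun z => g (z, τ)) (nhdsWithin x {x}ᶜ) (nhds (g (x, τ))) :=
    ((hg.comp (Continuous.prodMk_left τ)).tendsto x).mono_left nhdsWithin_le_nhds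
  refine tendsto_nhds_unique (hf'.congr' ?_) hg'
  filter_upwards [hne] with z hz
  exact mul_right_cancel₀ hz (h (z, τ))

/-! ### The action of translations and of the theta group -/

theorem modular_smul (γ : Gamma12) (p : ℂ × ℍ) :
    modular γ • p = (p.1 / autFactor γ p.2, (γ : SL(2, ℤ)) • p.2) := by
  change act (modular γ) p = _
  simp [act, modular]

theorem autFactor_one (τ : ℍ) : autFactor 1 τ = 1 := by
  obtain ⟨-, -, h3, h4⟩ := entries_one
  simp [autFactor, h3, h4]

theorem transl_smul (m n : ℤ) (p : ℂ × ℍ) : transl m n • p = (p.1 + m + n * p.2, p.2) := by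
  change act (transl m n) p = _
  simp [act, transl, autFactor_one]

theorem jacobiTheta₂_add_lattice (x τ : ℂ) (m n : ℤ) :
    jacobiTheta₂ (x + m + n * τ) τ =
      cexp (-(π * I * (n : ℂ) ^ 2 * τ) - 2 * π * I * n * x) * jacobiTheta₂ x τ := by
  -- Reindexing by k ↦ k + n completes the square in the exponent.
  conv_rhs => rw [jacobiTheta₂, ← tsum_mul_left, ← (Equiv.addRight n).tsum_eq]
  refine tsum_congr fun k => ?_
  simp only [jacobiTheta₂_term, ← Complex.exp_add, Equiv.coe_addRight]
  rw [← mul_one (cexp (-(π * I * (n : ℂ) ^ 2 * τ) - _ + _)), ← exp_two_pi_I_mul_int (k * m),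
    ← Complex.exp_add]
  congr 1
  push_cast
  ring

/-! ### The multiplier of the theta function -/

/-- The square of the theta multiplier. -/
def thetaMultSq (γ : Gamma12) (p : ℂ × ℍ) : ℂ :=
  zetaSq γ * autFactor γ p.2 * cexp (2 * π * I * ec γ * p.1 ^ 2 / autFactor γ p.2)

theorem thetaMultSq_mul (γ δ : Gamma12) (p : ℂ × ℍ) :
    thetaMultSq (γ * δ) p = thetaMultSq γ (modular δ • p) * thetaMultSq δ p := by
  have h1 := autFactor_ne_zero γ ((δ : SL(2, ℤ)) • p.2)
  have h2 := autFactor_ne_zero δ p.2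
  have hdet : (ea δ : ℂ) * ed δ - eb δ * ec δ = 1 := by exact_mod_cast det_eq δ
  -- The cocycle relation for c/(cτ+d), cleared of denominators.
  have key : (ec (γ * δ) : ℂ) * autFactor δ p.2 = ec γ + ec δ * autFactor (γ * δ) p.2 := by
    obtain ⟨-, -, h3, h4⟩ := entries_mul γ δ
    simp only [autFactor, h3, h4]
    push_cast
    linear_combination (ec γ : ℂ) * hdet
  have hexp : 2 * π * I * ec (γ * δ) * p.1 ^ 2 / autFactor (γ * δ) p.2 =
      2 * π * I * ec γ * (p.1 / autFactor δ p.2) ^ 2 / autFactor γ ((δ : SL(2, ℤ)) • p.2) +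
        2 * π * I * ec δ * p.1 ^ 2 / autFactor δ p.2 := by
    rw [autFactor_mul] at key ⊢
    field_simp
    linear_combination p.1 ^ 2 * key
  simp only [thetaMultSq, modular_smul]
  rw [zetaSq_mul, hexp, autFactor_mul, Complex.exp_add]
  ring

theorem thetaMultSq_one (p : ℂ × ℍ) : thetaMultSq 1 p = 1 := by
  simp [thetaMultSq, zetaSq_one, autFactor_one, entries_one.2.2.1]

theorem modular_mul (γ δ : Gamma12) : modular (γ * δ) = modular γ * modular δ :=
  map_mul SemidirectProduct.inr γ δ

theorem modular_one : modular 1 = 1 := map_one SemidirectProduct.inr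

theorem coe_inversion_smul (τ : ℍ) : (((inversion : SL(2, ℤ)) • τ : ℍ) : ℂ) = -1 / τ := by
  obtain ⟨h1, h2, h3, h4⟩ := entries_inversion
  rw [coe_smul_eq, autFactor, h1, h2, h3, h4]
  simp

theorem autFactor_inversion (τ : ℍ) : autFactor inversion τ = τ := by
  obtain ⟨h1, h2, h3, h4⟩ := entries_inversion
  simp [autFactor, h3, h4]

theorem coe_shiftTwo_smul (τ : ℍ) : (((shiftTwo : SL(2, ℤ)) • τ : ℍ) : ℂ) = τ + 2 := by
  obtain ⟨h1, h2, h3, h4⟩ := entries_shiftTwo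
  rw [coe_smul_eq, autFactor, h1, h2, h3, h4]
  simp

theorem autFactor_shiftTwo (τ : ℍ) : autFactor shiftTwo τ = 1 := by
  obtain ⟨h1, h2, h3, h4⟩ := entries_shiftTwo
  simp [autFactor, h3, h4]

theorem eighthRoot_neg_two : eighthRoot (-2) = -I := by
  rw [eighthRoot, show (π * I / 4 * ((-2 : ℤ) : ℂ)) = -(π / 2 * I) by push_cast; ring,
    Complex.exp_neg, Complex.exp_pi_div_two_mul_I, Complex.inv_I]

/-- There is a holomorphic multiplier of `θ` for each element of the theta group, and its square
is the explicit one. -/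
theorem exists_holo_thetaMult (γ : Gamma12) : ∃ D : ℂ × ℍ → ℂ, IsHolo D ∧
    (∀ p, theta (modular γ • p) = D p * theta p) ∧ ∀ p, D p ^ 2 = thetaMultSq γ p := by
  have hγ : γ ∈ Subgroup.closure {inversion, shiftTwo} := closure_generators ▸ Subgroup.mem_top γ
  induction hγ using Subgroup.closure_induction with
  | mem γ hγ =>
    rcases hγ with rfl | rfl
    · refine ⟨fun p => (-I * p.2) ^ (1 / 2 : ℂ) * cexp (π * I * p.1 ^ 2 / p.2), ?_, ?_, ?_⟩
      · refine isHolo_of_eq (fun w => (-I * w.2) ^ (1 / 2 : ℂ) * cexp (π * I * w.1 ^ 2 / w.2))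
          (fun _ _ => rfl) fun q hq => ?_
        have h0 : q.2 ≠ 0 := fun h => by simp [h] at hq
        have hs : -I * q.2 ∈ slitPlane := by
          left
          simpa using hq
        refine DifferentiableAt.mul ?_ ?_
        · exact DifferentiableAt.cpow (by fun_prop) (by fun_prop) hs
        · fun_prop (disch := exact h0)
      · intro p
        rw [modular_smul, theta, theta]
        simp only [coe_inversion_smul, autFactor_inversion]
        exact jacobiTheta₂_inversion p.1 p.2.im_pos
      · intro p
        have hrr : (-I * p.2) ^ (1 / 2 : ℂ) * (-I * p.2) ^ (1 / 2 : ℂ) = -I * p.2 := by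
          rw [← Complex.cpow_add _ _ (neg_I_mul_ne_zero p.2.im_pos)]
          norm_num
        rw [thetaMultSq, zetaSq_inversion, eighthRoot_neg_two, autFactor_inversion,
          entries_inversion.2.2.1, mul_pow, sq, hrr, ← Complex.exp_nat_mul]
        congr 2
        push_cast
        ring
    · refine ⟨fun _ => 1, isHolo_const 1, ?_, ?_⟩
      · intro p
        rw [modular_smul, theta, theta]
        simp only [coe_shiftTwo_smul, autFactor_shiftTwo, div_one, one_mul]
        exact jacobiTheta₂_add_right p.1 p.2
      · intro p
        simp [thetaMultSq, zetaSq_shiftTwo, autFactor_shiftTwo, entries_shiftTwo.2.2.1]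
  | one =>
    refine ⟨fun _ => 1, isHolo_const 1, fun p => ?_, fun p => ?_⟩
    · rw [modular_one, one_smul, one_mul]
    · rw [thetaMultSq_one, one_pow]
  | mul γ δ _ _ hγ hδ =>
    obtain ⟨D, h1, h2, h3⟩ := hγ
    obtain ⟨D', h1', h2', h3'⟩ := hδ
    refine ⟨fun p => D (modular δ • p) * D' p, (h1.comp_smul _).mul h1', fun p => ?_, fun p => ?_⟩
    · rw [modular_mul, mul_smul, h2, h2', mul_assoc]
    · rw [mul_pow, h3, h3', thetaMultSq_mul]
  | inv γ _ hγ =>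
    obtain ⟨D, h1, h2, h3⟩ := hγ
    have hW : ∀ p, D (modular γ⁻¹ • p) ^ 2 * thetaMultSq γ⁻¹ p = 1 := fun p => by
      rw [h3, ← thetaMultSq_mul, mul_inv_cancel, thetaMultSq_one]
    have hne : ∀ p, D (modular γ⁻¹ • p) ≠ 0 := fun p h => by
      have := hW p
      simp [h] at this
    refine ⟨fun p => (D (modular γ⁻¹ • p))⁻¹, (h1.comp_smul _).inv hne, fun p => ?_, fun p => ?_⟩
    · have := h2 (modular γ⁻¹ • p)
      rw [← mul_smul, ← modular_mul, mul_inv_cancel, modular_one, one_smul] at this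
      rw [this, inv_mul_cancel_left₀ (hne p)]
    · rw [inv_pow]
      exact (eq_inv_of_mul_eq_one_right (hW p)).symm

/-- If c ≠ 0 then cτ+d is never real, so it avoids the branch cut. If c = 0 it may lie on the cut,
but it is constant. -/
theorem isHolo_autFactor_cpow (γ : Gamma12) :
    IsHolo fun p => autFactor γ p.2 ^ (1 / 2 : ℂ) := by
  by_cases hc : ec γ = 0
  · have : (fun p : ℂ × ℍ => autFactor γ p.2 ^ (1 / 2 : ℂ)) =
        fun _ => (ed γ : ℂ) ^ (1 / 2 : ℂ) := by
      funext p
      simp [autFactor, hc]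
    rw [this]
    exact isHolo_const _
  · refine isHolo_of_eq (fun w => ((ec γ : ℂ) * w.2 + (ed γ : ℂ)) ^ (1 / 2 : ℂ)) (fun _ _ => rfl)
      fun q hq => DifferentiableAt.cpow (by fun_prop) (by fun_prop) ?_
    right
    have : (ec γ : ℝ) ≠ 0 := by exact_mod_cast hc
    simp [this, hq.ne']

theorem autFactor_cpow_sq (γ : Gamma12) (τ : ℍ) :
    (autFactor γ τ ^ (1 / 2 : ℂ)) ^ 2 = autFactor γ τ := by
  rw [sq, ← Complex.cpow_add _ _ (autFactor_ne_zero γ τ)]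
  norm_num

/-- The factor `(cτ+d)^{1/2} exp(πi c x²/(cτ+d))`. -/
def thetaFactor (γ : Gamma12) (p : ℂ × ℍ) : ℂ :=
  autFactor γ p.2 ^ (1 / 2 : ℂ) * cexp (π * I * ec γ * p.1 ^ 2 / autFactor γ p.2)

theorem isHolo_thetaFactor (γ : Gamma12) : IsHolo (thetaFactor γ) := by
  have h1 : IsHolo fun p : ℂ × ℍ => π * I * ec γ * p.1 ^ 2 := by
    simp only [sq]
    exact (isHolo_const _).mul (isHolo_fst.mul isHolo_fst)
  exact (isHolo_autFactor_cpow γ).mul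
    (h1.div (isHolo_autFactor γ) fun p => autFactor_ne_zero γ p.2).cexp

theorem thetaFactor_sq (γ : Gamma12) (p : ℂ × ℍ) :
    zetaSq γ * thetaFactor γ p ^ 2 = thetaMultSq γ p := by
  have h : ((2 : ℕ) : ℂ) * (π * I * ec γ * p.1 ^ 2 / autFactor γ p.2) =
      2 * π * I * ec γ * p.1 ^ 2 / autFactor γ p.2 := by
    push_cast
    ring
  rw [thetaFactor, thetaMultSq, mul_pow, autFactor_cpow_sq, ← Complex.exp_nat_mul, h]
  ring

theorem thetaFactor_ne_zero (γ : Gamma12) (p : ℂ × ℍ) : thetaFactor γ p ≠ 0 := by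
  refine mul_ne_zero ?_ (Complex.exp_ne_zero _)
  intro h
  have := autFactor_cpow_sq γ p.2
  rw [h] at this
  exact autFactor_ne_zero γ p.2 (by simpa using this.symm)

theorem isThetaMultiplier_iff (γ : Gamma12) (z : ℂ) : IsThetaMultiplier γ z ↔
    ∀ p, theta (modular γ • p) = z * thetaFactor γ p * theta p := by
  constructor
  · intro h p
    rw [modular_smul, h, thetaFactor]
    ring
  · intro h x τ
    have := h (x, τ)
    rw [modular_smul] at this
    rw [this, thetaFactor]
    ring

theorem IsThetaMultiplier.unique {γ : Gamma12} {z z' : ℂ} (h : IsThetaMultiplier γ z)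
    (h' : IsThetaMultiplier γ z') : z = z' := by
  rw [isThetaMultiplier_iff] at h h'
  have hc := (isHolo_thetaFactor γ).continuous
  have := eq_of_mul_theta_eq (continuous_const.mul hc) (continuous_const.mul hc)
    (fun p => (h p).symm.trans (h' p)) (0, UpperHalfPlane.I)
  exact mul_right_cancel₀ (thetaFactor_ne_zero γ _) this

/-- The quotient of the holomorphic multiplier by `thetaFactor` is continuous with constant nonzero
square, hence constant on the connected space ℂ × ℍ. -/
theorem exists_isThetaMultiplier (γ : Gamma12) :
    ∃ z, IsThetaMultiplier γ z ∧ z ^ 2 = zetaSq γ := by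
  obtain ⟨D, h1, h2, h3⟩ := exists_holo_thetaMult γ
  have h0 := thetaFactor_ne_zero γ
  obtain ⟨c, hc⟩ : ∃ c : ℂ, c ^ 2 = zetaSq γ := IsAlgClosed.exists_pow_nat_eq _ two_pos
  have hc0 : c ≠ 0 := fun h => zetaSq_ne_zero γ (by rw [← hc, h]; simp)
  have hcont : ContinuousOn (fun p => D p / thetaFactor γ p) Set.univ :=
    (h1.div (isHolo_thetaFactor γ) h0).continuous.continuousOn
  have hsq : Set.EqOn ((fun p => D p / thetaFactor γ p) ^ 2) ((fun _ => c) ^ 2) Set.univ := by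
    intro p _
    simp only [Pi.pow_apply, div_pow]
    rw [h3, ← thetaFactor_sq, hc, mul_div_cancel_right₀ _ (pow_ne_zero 2 (h0 p))]
  have hmul : ∀ z, (∀ p, D p / thetaFactor γ p = z) → IsThetaMultiplier γ z := by
    intro z hz
    rw [isThetaMultiplier_iff]
    intro p
    rw [h2, ← hz p, div_mul_cancel₀ _ (h0 p)]
  rcases isPreconnected_univ.eq_or_eq_neg_of_sq_eq hcont continuousOn_const hsq
    (fun _ => hc0) with h | h
  · exact ⟨c, hmul c fun p => h (Set.mem_univ p), hc⟩
  · exact ⟨-c, hmul (-c) fun p => h (Set.mem_univ p), by rw [neg_sq, hc]⟩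

/-! ### The scalar cocycles on the diagonal -/

/-- The cocycle of the twisted line bundle of order two: the upper left entry. -/
def twistMult (g : UnivGroup) (p : ℂ × ℍ) : ℂ :=
  cexp (π * I * g.left.toAdd.2 * ((((g.right : SL(2, ℤ)) • p.2 : ℍ) : ℂ) + 1)) *
    (cexp (3 * π * I / 4 * ((p.2 : ℂ) - (((g.right : SL(2, ℤ)) • p.2 : ℍ) : ℂ))) *
      (zetaSq g.right)⁻¹ * (chi g.right)⁻¹ * autFactor g.right p.2 * etaFactor g.right p)

/-- The function `exp(πix - 3πiτ/4)`. -/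
def expFactor (p : ℂ × ℍ) : ℂ := cexp (π * I * p.1 - 3 * π * I * p.2 / 4)

/-- The character `(m, n, γ) ↦ (-1)^{m+n} ζ(γ)⁻² χ(γ)⁻¹` of the group. -/
def twistChar (g : UnivGroup) : ℂ :=
  (-1 : ℂ) ^ (g.left.toAdd.1 + g.left.toAdd.2) * (zetaSq g.right)⁻¹ * (chi g.right)⁻¹

theorem expFactor_ne_zero (p : ℂ × ℍ) : expFactor p ≠ 0 := Complex.exp_ne_zero _

theorem isHolo_expFactor : IsHolo expFactor :=
  (((isHolo_const _).mul isHolo_fst).sub (((isHolo_const _).mul isHolo_snd).div (isHolo_const 4)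
    fun _ => by norm_num)).cexp

theorem neg_one_zpow_eq_exp (k : ℤ) : (-1 : ℂ) ^ k = cexp (π * I * k) := by
  rw [← Complex.exp_pi_mul_I, ← Complex.exp_int_mul, mul_comm]

/-- The cocycle property becomes visible in this form: a coboundary, a character and the weight-one
factor cτ+d. -/
theorem twistMult_eq (g : UnivGroup) (p : ℂ × ℍ) :
    twistMult g p = expFactor (g • p) / expFactor p * twistChar g * autFactor g.right p.2 := by
  have hsmul : g • p = (p.1 / autFactor g.right p.2 + (g.left.toAdd.1 : ℂ)
      + (g.left.toAdd.2 : ℂ) * (((g.right : SL(2, ℤ)) • p.2 : ℍ) : ℂ),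
      (g.right : SL(2, ℤ)) • p.2) := rfl
  -- The sign of m is reversed so that exp(-πim) cancels the exp(πim) coming from `expFactor`, while
  -- exp(πin) supplies the +1 in exp(πin(γτ+1)).
  have hpar : (-1 : ℂ) ^ (g.left.toAdd.1 + g.left.toAdd.2) =
      cexp (-(π * I * g.left.toAdd.1) + π * I * g.left.toAdd.2) := by
    have h : (-1 : ℂ) ^ (g.left.toAdd.1 + g.left.toAdd.2) =
        (-1 : ℂ) ^ (-g.left.toAdd.1 + g.left.toAdd.2) := by
      rw [zpow_add₀ (by norm_num), zpow_add₀ (by norm_num), zpow_neg, ← inv_zpow, inv_neg_one]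
    rw [h, neg_one_zpow_eq_exp]
    congr 1
    push_cast
    ring
  have hcomb : ∀ a b c d e f z x j : ℂ, a + (b + c) = d - e + f →
      cexp a * (cexp b * z * x * j * cexp c) = cexp d / cexp e * (cexp f * z * x) * j := by
    intro a b c d e f z x j h
    rw [← Complex.exp_sub]
    have h' : cexp a * (cexp b * cexp c) = cexp (d - e) * cexp f := by
      rw [← Complex.exp_add, ← Complex.exp_add, ← Complex.exp_add, h]
    linear_combination z * x * j * h'
  rw [twistMult, twistChar, hpar, expFactor, expFactor, etaFactor, hsmul]
  apply hcomb
  ring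

theorem twistChar_mul (g h : UnivGroup) : twistChar (g * h) = twistChar g * twistChar h := by
  have hpar : (-1 : ℂ) ^ ((g * h).left.toAdd.1 + (g * h).left.toAdd.2) =
      (-1 : ℂ) ^ (g.left.toAdd.1 + g.left.toAdd.2) *
        (-1 : ℂ) ^ (h.left.toAdd.1 + h.left.toAdd.2) := by
    have e1 : (g * h).left.toAdd.1 + (g * h).left.toAdd.2 =
        (g.left.toAdd.1 + g.left.toAdd.2) +
        ((ea g.right * h.left.toAdd.1 - eb g.right * h.left.toAdd.2) +
          (-ec g.right * h.left.toAdd.1 + ed g.right * h.left.toAdd.2)) := by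
      change (g.left.toAdd.1 + (ea g.right * h.left.toAdd.1 - eb g.right * h.left.toAdd.2)) +
        (g.left.toAdd.2 + (-ec g.right * h.left.toAdd.1 + ed g.right * h.left.toAdd.2)) = _
      ring
    rw [e1, zpow_add₀ (by norm_num)]
    congr 1
    generalize h.left.toAdd.1 = m
    generalize h.left.toAdd.2 = n
    -- Modulo 2 the matrix is the identity or the swap, so it preserves the parity of m + n.
    have hdiff : ∃ l : ℤ, ea g.right * m - eb g.right * n + (-ec g.right * m + ed g.right * n) =
        m + n + 2 * l := by
      rcases entries_parity g.right with ⟨p, q, r, s, ha, hb, hc, hd⟩ | ⟨p, q, r, s, ha, hb, hc, hd⟩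
      · exact ⟨p * m - q * n - r * m + s * n, by rw [ha, hb, hc, hd]; ring⟩
      · exact ⟨p * m - q * n - r * m + s * n - m - n, by rw [ha, hb, hc, hd]; ring⟩
    obtain ⟨l, hl⟩ := hdiff
    rw [hl, zpow_add₀ (by norm_num), (even_two_mul l).neg_one_zpow, mul_one]
  rw [twistChar, twistChar, twistChar, hpar, SemidirectProduct.mul_right, zetaSq_mul, chi_mul,
    mul_inv, mul_inv]
  ring

theorem twistChar_ne_zero (g : UnivGroup) : twistChar g ≠ 0 :=
  mul_ne_zero (mul_ne_zero (zpow_ne_zero _ (by norm_num)) (inv_ne_zero (zetaSq_ne_zero _)))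
    (inv_ne_zero (chi_ne_zero _))

theorem twistMult_mul (g h : UnivGroup) (p : ℂ × ℍ) :
    twistMult (g * h) p = twistMult g (h • p) * twistMult h p := by
  have h1 := expFactor_ne_zero p
  have h2 := expFactor_ne_zero (h • p)
  have h3 : autFactor (g * h).right p.2 =
      autFactor g.right (h • p).2 * autFactor h.right p.2 := autFactor_mul g.right h.right p.2
  rw [twistMult_eq, twistMult_eq, twistMult_eq, twistChar_mul, mul_smul, h3]
  field_simp

theorem twistMult_ne_zero (g : UnivGroup) (p : ℂ × ℍ) : twistMult g p ≠ 0 := by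
  rw [twistMult_eq]
  exact mul_ne_zero (mul_ne_zero (div_ne_zero (expFactor_ne_zero _) (expFactor_ne_zero _))
    (twistChar_ne_zero g)) (autFactor_ne_zero _ _)

theorem isHolo_twistMult (g : UnivGroup) : IsHolo (twistMult g) := by
  rw [funext (twistMult_eq g)]
  exact (((isHolo_expFactor.comp_smul g).div isHolo_expFactor expFactor_ne_zero).mul
    (isHolo_const _)).mul (isHolo_autFactor g.right)

theorem twistMult_one (p : ℂ × ℍ) : twistMult 1 p = 1 := by
  have := twistMult_mul 1 1 p
  rw [mul_one, one_smul] at this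
  exact (mul_eq_left₀ (twistMult_ne_zero 1 p)).1 this.symm

/-- The cocycle of the theta line bundle: the lower right entry. -/
def thetaMult (ζ : Gamma12 → ℂ) (g : UnivGroup) (p : ℂ × ℍ) : ℂ :=
  cexp (-(π * I * (g.left.toAdd.2 : ℂ) ^ 2 * (((g.right : SL(2, ℤ)) • p.2 : ℍ) : ℂ)) -
      2 * π * I * g.left.toAdd.2 * (p.1 / autFactor g.right p.2)) *
    (ζ g.right * thetaFactor g.right p)

/-- `ζ` is a choice of theta multipliers whose squares are the explicit ones. -/
def IsMultiplierSystem (ζ : Gamma12 → ℂ) : Prop :=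
  ∀ γ, IsThetaMultiplier γ (ζ γ) ∧ ζ γ ^ 2 = zetaSq γ

variable {ζ : Gamma12 → ℂ}

theorem IsMultiplierSystem.ne_zero (hζ : IsMultiplierSystem ζ) (γ : Gamma12) : ζ γ ≠ 0 :=
  fun h => zetaSq_ne_zero γ (by rw [← (hζ γ).2, h]; simp)

theorem IsMultiplierSystem.map_one (hζ : IsMultiplierSystem ζ) : ζ 1 = 1 := by
  refine (hζ 1).1.unique ((isThetaMultiplier_iff 1 1).2 fun p => ?_)
  rw [modular_one, one_smul, thetaFactor, autFactor_one, entries_one.2.2.1]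
  simp

theorem isHolo_thetaMult (ζ : Gamma12 → ℂ) (g : UnivGroup) : IsHolo (thetaMult ζ g) :=
  ((((isHolo_const _).mul (isHolo_smul g.right)).neg.sub ((isHolo_const _).mul
    (isHolo_fst.div (isHolo_autFactor g.right) fun p => autFactor_ne_zero _ p.2))).cexp).mul
    ((isHolo_const _).mul (isHolo_thetaFactor g.right))

theorem thetaMult_ne_zero (hζ : IsMultiplierSystem ζ) (g : UnivGroup) (p : ℂ × ℍ) :
    thetaMult ζ g p ≠ 0 :=
  mul_ne_zero (Complex.exp_ne_zero _) (mul_ne_zero (hζ.ne_zero _) (thetaFactor_ne_zero _ _))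

theorem eq_transl_mul_modular (g : UnivGroup) :
    g = transl g.left.toAdd.1 g.left.toAdd.2 * modular g.right :=
  (SemidirectProduct.inl_left_mul_inr_right g).symm

theorem theta_smul (hζ : IsMultiplierSystem ζ) (g : UnivGroup) (p : ℂ × ℍ) :
    theta (g • p) = thetaMult ζ g p * theta p := by
  have h1 : g • p = transl g.left.toAdd.1 g.left.toAdd.2 • modular g.right • p := by
    rw [← mul_smul, ← eq_transl_mul_modular]
  have h2 := (isThetaMultiplier_iff _ _).1 (hζ g.right).1 p
  rw [h1, transl_smul, thetaMult, mul_assoc, ← h2, theta]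
  simp only [jacobiTheta₂_add_lattice]
  rw [modular_smul]
  rfl

/-- Both sides describe θ(ghp) as a multiple of θ(p), so cancelling θ gives the relation without any
comparison of square-root branches. -/
theorem thetaMult_mul (hζ : IsMultiplierSystem ζ) (g h : UnivGroup) (p : ℂ × ℍ) :
    thetaMult ζ (g * h) p = thetaMult ζ g (h • p) * thetaMult ζ h p := by
  refine eq_of_mul_theta_eq (isHolo_thetaMult ζ _).continuous
    (((isHolo_thetaMult ζ g).comp_smul h).mul (isHolo_thetaMult ζ h)).continuous (fun p => ?_) p
  rw [← theta_smul hζ, mul_smul, theta_smul hζ, theta_smul hζ, mul_assoc]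

/-! ### The off-diagonal entry -/

/-- `b` is the off-diagonal entry attached to `g`. -/
def IsOffDiagonal (g : UnivGroup) (b : ℂ × ℍ → ℂ) : Prop :=
  IsHolo b ∧ ∀ p, kappaHalf (g • p) = twistMult g p * kappaHalf p + b p * theta p

theorem IsOffDiagonal.unique {g : UnivGroup} {b b' : ℂ × ℍ → ℂ} (h : IsOffDiagonal g b)
    (h' : IsOffDiagonal g b') (p : ℂ × ℍ) : b p = b' p := by
  refine eq_of_mul_theta_eq h.1.continuous h'.1.continuous (fun p => ?_) p
  linear_combination h'.2 p - h.2 p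

/-- The new entry is the upper right entry of a product of upper triangular matrices. With
`IsOffDiagonal.inv` it makes the admissible g a subgroup. -/
theorem IsOffDiagonal.mul (hζ : IsMultiplierSystem ζ) {g h : UnivGroup} {b b' : ℂ × ℍ → ℂ}
    (hb : IsOffDiagonal g b) (hb' : IsOffDiagonal h b') :
    IsOffDiagonal (g * h)
      fun p => twistMult g (h • p) * b' p + b (h • p) * thetaMult ζ h p := by
  refine ⟨(((isHolo_twistMult g).comp_smul h).mul hb'.1).add
    ((hb.1.comp_smul h).mul (isHolo_thetaMult ζ h)), fun p => ?_⟩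
  rw [mul_smul, hb.2, hb'.2, theta_smul hζ, twistMult_mul]
  ring

theorem IsOffDiagonal.inv (hζ : IsMultiplierSystem ζ) {g : UnivGroup} {b : ℂ × ℍ → ℂ}
    (hb : IsOffDiagonal g b) :
    IsOffDiagonal g⁻¹ fun p => -(twistMult g⁻¹ p * b (g⁻¹ • p) * thetaMult ζ g⁻¹ p) := by
  refine ⟨(((isHolo_twistMult _).mul (hb.1.comp_smul _)).mul (isHolo_thetaMult ζ _)).neg,
    fun p => ?_⟩
  have h1 := hb.2 (g⁻¹ • p)
  have h2 := twistMult_mul g g⁻¹ p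
  have h3 := theta_smul hζ g⁻¹ p
  rw [smul_inv_smul] at h1
  rw [mul_inv_cancel, twistMult_one] at h2
  linear_combination (-twistMult g⁻¹ p) * h1 + kappaHalf (g⁻¹ • p) * h2 -
    twistMult g⁻¹ p * b (g⁻¹ • p) * h3

theorem isOffDiagonal_transl_one : IsOffDiagonal (transl 1 0) fun _ => 0 := by
  refine ⟨isHolo_const 0, fun p => ?_⟩
  have h : twistMult (transl 1 0) p = 1 := by
    simp [twistMult, transl, zetaSq_one, chi_one, autFactor_one, etaFactor]
  rw [h, transl_smul, kappaHalf_eq, kappaHalf_eq]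
  simp [kappaSeries_add_one]

theorem isOffDiagonal_transl_tau : IsOffDiagonal (transl 0 1) fun _ => 1 := by
  refine ⟨isHolo_const 1, fun p => ?_⟩
  have h : twistMult (transl 0 1) p = cexp (π * I * (p.2 + 1)) := by
    simp [twistMult, transl, zetaSq_one, chi_one, autFactor_one, etaFactor]
  rw [h, transl_smul, kappaHalf_eq, kappaHalf_eq, theta]
  simp [kappaSeries_add_tau p.1 p.2.im_pos]

theorem isOffDiagonal_shiftTwo : IsOffDiagonal (modular shiftTwo) fun _ => 0 := by
  refine ⟨isHolo_const 0, fun p => ?_⟩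
  have h : twistMult (modular shiftTwo) p = 1 := by
    -- exp(-3πi/2) χ(T²)⁻¹ = exp(-2πi): the character compensates the normalizing factor
    -- exp(3πiτ/4).
    have e : cexp (3 * π * I / 4 * (p.2 - (p.2 + 2))) * (eighthRoot 2)⁻¹ = 1 := by
      rw [eighthRoot, ← Complex.exp_neg, ← Complex.exp_add, Complex.exp_eq_one_iff]
      exact ⟨-1, by push_cast; ring⟩
    simp only [twistMult, modular, SemidirectProduct.left_inr, SemidirectProduct.right_inr,
      coe_shiftTwo_smul, zetaSq_shiftTwo, chi_shiftTwo, autFactor_shiftTwo, etaFactor, inv_one,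
      mul_one, e]
    simp
  rw [h, modular_smul, kappaHalf_eq, kappaHalf_eq]
  simp only [coe_shiftTwo_smul, autFactor_shiftTwo, div_one, kappaSeries_add_two]
  ring

theorem appellM_eq (p : ℂ × ℍ) : appellM p.1 p.2 = (expFactor p)⁻¹ * kappaHalf p := by
  rw [appellM, expFactor, kappaHalf_eq, ← Complex.exp_neg]
  congr 2
  ring

/-- This is `appellM_inversion` multiplied by `expFactor` at the image point; the Mordell integral
is holomorphic in (x, τ), hence so is the entry. -/
theorem isOffDiagonal_inversion : IsOffDiagonal (modular inversion)
    fun p => -(I * p.2 / 2) * expFactor (modular inversion • p) * mordell p.1 p.2 := by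
  have hm : IsHolo fun p : ℂ × ℍ => mordell p.1 p.2 :=
    isHolo_of_eq (fun w => mordell w.1 w.2) (fun _ _ => rfl) fun _ hq => differentiableAt_mordell hq
  refine ⟨((((isHolo_const I).mul isHolo_snd).div (isHolo_const 2)
    fun _ => by norm_num).neg.mul (isHolo_expFactor.comp_smul _)).mul hm,
    fun p => ?_⟩
  -- ζ(S)⁻² χ(S)⁻¹ = (-i)⁻¹ = i, the constant in the inversion law.
  have hchar : twistChar (modular inversion) = I := by
    simp [twistChar, modular, zetaSq_inversion, chi_inversion, eighthRoot_neg_two]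
  have haut : autFactor (modular inversion).right p.2 = p.2 := autFactor_inversion p.2
  have key := appellM_inversion p.1 p.2.im_pos
  have hl := appellM_eq (modular inversion • p)
  have hsm : appellM (modular inversion • p).1 (modular inversion • p).2 =
      appellM (p.1 / p.2) (-1 / p.2) := by
    rw [modular_smul]
    simp only [coe_inversion_smul, autFactor_inversion]
  have hE := expFactor_ne_zero (modular inversion • p)
  have hl' : kappaHalf (modular inversion • p) =
      expFactor (modular inversion • p) * appellM (p.1 / p.2) (-1 / p.2) := by
    rw [← hsm, hl, mul_inv_cancel_left₀ hE]
  rw [twistMult_eq, hchar, haut, hl', key, appellM_eq, theta]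
  ring

theorem exists_isOffDiagonal (hζ : IsMultiplierSystem ζ) (g : UnivGroup) :
    ∃ b, IsOffDiagonal g b := by
  let H : Subgroup UnivGroup :=
    { carrier := {g | ∃ b, IsOffDiagonal g b}
      one_mem' := ⟨fun _ => 0, isHolo_const 0, fun p => by
        rw [one_smul, twistMult_one, one_mul, zero_mul, add_zero]⟩
      mul_mem' := fun ⟨_, h⟩ ⟨_, h'⟩ => ⟨_, h.mul hζ h'⟩
      inv_mem' := fun ⟨_, h⟩ => ⟨_, h.inv hζ⟩ }
  have h1 : transl 1 0 ∈ H := ⟨_, isOffDiagonal_transl_one⟩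
  have h2 : transl 0 1 ∈ H := ⟨_, isOffDiagonal_transl_tau⟩
  have h3 : ∀ γ, modular γ ∈ H := by
    intro γ
    have : (⊤ : Subgroup Gamma12) ≤ H.comap SemidirectProduct.inr := by
      rw [← closure_generators, Subgroup.closure_le]
      rintro _ (rfl | rfl)
      · exact ⟨_, isOffDiagonal_inversion⟩
      · exact ⟨_, isOffDiagonal_shiftTwo⟩
    exact this (Subgroup.mem_top γ)
  have h4 : ∀ m n : ℤ, transl m n = transl 1 0 ^ m * transl 0 1 ^ n := by
    intro m n
    simp only [transl, ← map_zpow, ← map_mul, ← ofAdd_zsmul, ← ofAdd_add]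
    simp
  have h5 : g ∈ H := by
    rw [eq_transl_mul_modular g, h4]
    exact H.mul_mem (H.mul_mem (H.zpow_mem h1 _) (H.zpow_mem h2 _)) (h3 _)
  exact h5

/-! ### Assembling the matrix cocycle -/

/-- The matrix with given diagonal and upper right entry. -/
def upperTriangular (a b d : ℂ) (ha : a ≠ 0) (hd : d ≠ 0) : GL (Fin 2) ℂ :=
  Matrix.GeneralLinearGroup.mkOfDetNeZero !![a, b; 0, d] (by
    rw [Matrix.det_fin_two_of, mul_zero, sub_zero]
    exact mul_ne_zero ha hd)

theorem coe_upperTriangular (a b d : ℂ) (ha : a ≠ 0) (hd : d ≠ 0) :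
    (upperTriangular a b d ha hd : Matrix (Fin 2) (Fin 2) ℂ) = !![a, b; 0, d] := rfl

end AppellKappa

end

open AppellKappa in
theorem mainTheorem1 :
    ∃ ζ : Gamma12 → ℂ,
      -- `ζ γ` is the multiplier of the theta transformation law, an eighth root of unity
      (∀ (γ : Gamma12) (z : ℂ), IsThetaMultiplier γ z ↔ z = ζ γ) ∧
      (∀ γ : Gamma12, ζ γ ^ 8 = 1 ∧ ζ γ ^ 2 = zetaSq γ) ∧
      -- `χ` is a character with values in the fourth roots of unity
      (∀ γ δ : Gamma12, chi (γ * δ) = chi γ * chi δ) ∧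
      (∀ γ : Gamma12, chi γ ^ 4 = 1) ∧
      -- divisibility by `θ` in the ring of holomorphic functions
      (∃ hθ : theta ∈ holoRing, ∀ γ : Gamma12, ∃ hκ : kappaDefect (ζ γ) γ ∈ holoRing,
        (⟨theta, hθ⟩ : holoRing) ∣ ⟨kappaDefect (ζ γ) γ, hκ⟩) ∧
      -- the pair `(κ, θ)` is a section of a rank-two extension bundle
      (∃ C : UnivGroup → ℂ × UpperHalfPlane → GL (Fin 2) ℂ,
        IsCocycle C ∧
        IsThetaExtension ζ C ∧
        IsSection C (fun p => ![kappaHalf p, theta p])) := by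
  choose ζ hζ using exists_isThetaMultiplier
  have hS : IsMultiplierSystem ζ := hζ
  choose b hb using exists_isOffDiagonal hS
  have htwist : ∀ (γ : Gamma12) (p : ℂ × UpperHalfPlane), twistMult (modular γ) p =
      kFactor (ζ γ) γ p.2 * etaFactor γ p := by
    intro γ p
    simp [twistMult, kFactor, modular, (hζ γ).2]
  refine ⟨ζ, fun γ z => ⟨fun h => h.unique (hζ γ).1, fun h => h ▸ (hζ γ).1⟩,
    fun γ => ⟨?_, (hζ γ).2⟩, chi_mul, chi_pow_four, ⟨isHolo_theta, fun γ => ?_⟩, ?_⟩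
  · rw [show ζ γ ^ 8 = (ζ γ ^ 2) ^ 4 by ring, (hζ γ).2, zetaSq_pow_four]
  · have hexp : IsHolo fun p =>
        cexp (3 * π * I * (((γ : SL(2, ℤ)) • p.2 : UpperHalfPlane) : ℂ) / 4) :=
      (((isHolo_const _).mul (isHolo_smul γ)).div (isHolo_const 4)
        fun _ => by norm_num).cexp
    have hq : IsHolo fun p =>
        cexp (3 * π * I * (((γ : SL(2, ℤ)) • p.2 : UpperHalfPlane) : ℂ) / 4) * b (modular γ) p :=
      hexp.mul (hb (modular γ)).1
    -- The quotient by θ is the upper right entry for γ, rescaled by exp(3πiγτ/4) in passing from κ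
    -- to κ₀.
    have hdef : kappaDefect (ζ γ) γ = fun p => theta p *
        (cexp (3 * π * I * (((γ : SL(2, ℤ)) • p.2 : UpperHalfPlane) : ℂ) / 4) *
          b (modular γ) p) := by
      funext p
      have h1 := (hb (modular γ)).2 p
      rw [htwist, modular_smul] at h1
      have h2 : cexp (3 * π * I * (((γ : SL(2, ℤ)) • p.2 : UpperHalfPlane) : ℂ) / 4) *
          cexp (3 * π * I / 4 * ((p.2 : ℂ) - (((γ : SL(2, ℤ)) • p.2 : UpperHalfPlane) : ℂ))) =
          cexp (3 * π * I * p.2 / 4) := by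
        rw [← Complex.exp_add]
        congr 1
        ring
      rw [kappaDefect, kappa0, kappa0, h1, kFactor, ← h2]
      ring
    refine ⟨?_, ⟨⟨_, hq⟩, Subtype.ext hdef⟩⟩
    rw [hdef]
    exact isHolo_theta.mul hq
  · refine ⟨fun g p => upperTriangular (twistMult g p) (b g p) (thetaMult ζ g p)
      (twistMult_ne_zero g p) (thetaMult_ne_zero hS g p), ⟨fun g i j => ?_, fun g h p => ?_⟩,
      ⟨fun m n x τ => ⟨b (transl m n) (x, τ), ?_⟩, fun p => ?_, fun x τ => ?_,
        fun γ x τ => ⟨b (modular γ) (x, τ), ?_⟩⟩, ⟨fun i => ?_, fun g p => ?_⟩⟩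
    · fin_cases i <;> fin_cases j
      · exact isHolo_twistMult g
      · exact (hb g).1
      · exact isHolo_const 0
      · exact isHolo_thetaMult ζ g
    -- The entries b were chosen separately for each group element; uniqueness forces the product
    -- rule.
    · have hbmul := (hb (g * h)).unique ((hb g).mul hS (hb h)) p
      apply Units.ext
      rw [Units.val_mul, coe_upperTriangular, coe_upperTriangular, coe_upperTriangular, hbmul,
        twistMult_mul, thetaMult_mul hS]
      simp
    · have h1 : twistMult (transl m n) (x, τ) = cexp (π * I * n * (τ + 1)) := by
        simp [twistMult, transl, zetaSq_one, chi_one, autFactor_one, etaFactor]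
      have h2 : thetaMult ζ (transl m n) (x, τ) =
          cexp (-(π * I * (n : ℂ) ^ 2 * τ) - 2 * π * I * n * x) := by
        simp [thetaMult, transl, thetaFactor, hS.map_one, autFactor_one, entries_one]
      rw [coe_upperTriangular, h1, h2]
    -- Uniqueness also identifies the chosen entry with the explicit one, here 0 and for (0, 1) the
    -- constant 1.
    · have h0 := (hb (transl 1 0)).unique isOffDiagonal_transl_one p
      have h1 : twistMult (transl 1 0) p = 1 := by
        simp [twistMult, transl, zetaSq_one, chi_one, autFactor_one, etaFactor]
      have h2 : thetaMult ζ (transl 1 0) p = 1 := by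
        simp [thetaMult, transl, thetaFactor, hS.map_one, autFactor_one, entries_one]
      apply Units.ext
      rw [coe_upperTriangular, h0, h1, h2, Units.val_one, Matrix.one_fin_two]
    · have h0 := (hb (transl 0 1)).unique isOffDiagonal_transl_tau (x, τ)
      have h1 : twistMult (transl 0 1) (x, τ) = cexp (π * I * (τ + 1)) := by
        simp [twistMult, transl, zetaSq_one, chi_one, autFactor_one, etaFactor]
      have h2 : thetaMult ζ (transl 0 1) (x, τ) = cexp (-(π * I * τ) - 2 * π * I * x) := by
        simp [thetaMult, transl, thetaFactor, hS.map_one, autFactor_one, entries_one]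
      rw [coe_upperTriangular, h0, h1, h2]
    · have h2 : thetaMult ζ (modular γ) (x, τ) = ζ γ * autFactor γ τ ^ (1 / 2 : ℂ) *
          cexp (π * I * ec γ * x ^ 2 / autFactor γ τ) := by
        simp [thetaMult, modular, thetaFactor, mul_assoc]
      rw [coe_upperTriangular, htwist, h2]
    · fin_cases i
      · exact isHolo_kappaHalf
      · exact isHolo_theta
    · rw [coe_upperTriangular, (hb g).2, theta_smul hS]
      ext i
      fin_cases i <;> simp [Matrix.mulVec, dotProduct, Fin.sum_univ_two]
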